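/- Let $S_n$ be the group of permutations of $[n]=\{1,\dots,n\}$, with composition $\sigma\tau=\sigma\circ\tau$, and write $\sigma\in S_n$ as the vector $[\sigma(1),\dots,\sigma(n)]$. For $1<j\le n$ let $t_{\uparrow j}:S_n\to S_n$ be the push-to-the-top transition $$t_{\uparrow j}([a_1,\dots,a_n])=[a_j,a_1,\dots,a_{j-1},a_{j+1},\dots,a_n].$$ A $G_\uparrow(n,M)$ code is a sequence $C=(c_1,\dots,c_M)$ of $M\ge 1$ distinct elements of $S_n$ such that for every $1\le r<M$ there is $1<j\le n$ with $c_{r+1}=t_{\uparrow j}(c_r)$, and there is $1<j\le n$ with $c_1=t_{\uparrow j}(c_M)$. A $G^{\mathrm{aux}}_\uparrow(k,M)$ code is a $G_\uparrow(k,M)$ code $C$ such that for every $q\in[k-1]$ and every $\sigma\in C$ one has $(q,k)\circ\sigma\notin C$, where $(q,k)$ is the transposition of $q$ and $k$. Then there are real numbers $\rho_k$, for even $k>6$, with $\rho_k>\frac{k-3}{k}$, such that for every $k\ge 3$ there exists a $G^{\mathrm{aux}}_\uparrow(k,\tilde M_k)$ code with $c_1=\mathrm{id}$ and $c_2=t_{\uparrow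 k}(\mathrm{id})$, where $$\tilde M_k=\begin{cases}8 & k=4,\\ 57 & k=5,\\ 178 & k=6,\\ \frac{k!}{2} & k \text{ odd},\ k\ne 5,\\ \rho_k\,\frac{k!}{2} & k \text{ even},\ k>6.\end{cases}$$ -/

import Mathlib

open Equiv

namespace PushToTop

/-! `S_n` is `Equiv.Perm (Fin n)`: the set `{1, …, n}` is represented by `Fin n`, the element `a`
being represented by `a - 1`.  The vector notation of `σ` is `[σ 0, σ 1, …, σ (n - 1)]`, and the
product `σ * τ` is the composition `σ ∘ τ`. -/

/-- The push-to-the-`i`th-index transition `t_{i↑j}` (for `i < j`): it moves the entry of the vector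
notation at index `j` to index `i` and shifts the entries at indices `i, …, j - 1` one step to the
right.  As a map, `σ ↦ σ ∘ (j, j-1, …, i)`. -/
def pushTo {n : ℕ} (i j : Fin n) (σ : Perm (Fin n)) : Perm (Fin n) :=
  σ * (Fin.cycleIcc i j)⁻¹

theorem pushTo_apply_left {n : ℕ} {i j : Fin n} (hij : i ≤ j) (σ : Perm (Fin n)) :
    pushTo i j σ i = σ j := by
  have : NeZero n := ⟨by have := i.isLt; omega⟩
  simp only [pushTo, Perm.mul_apply]
  rw [Perm.inv_eq_iff_eq.mpr (Fin.cycleIcc_of_last hij).symm]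

theorem pushTo_apply_succ {n : ℕ} {i j p q : Fin n} (hip : i ≤ p) (hpj : p < j)
    (hq : (q : ℕ) = p + 1) (σ : Perm (Fin n)) : pushTo i j σ q = σ p := by
  have : NeZero n := ⟨by have := i.isLt; omega⟩
  have h : Fin.cycleIcc i j p = q := by
    rw [Fin.cycleIcc_of_ge_of_lt hip hpj]
    have := j.isLt
    have h1 : (p : ℕ) < j := hpj
    apply Fin.ext
    rw [Fin.val_add_one_of_lt' (by omega), hq]
  simp only [pushTo, Perm.mul_apply]
  rw [Perm.inv_eq_iff_eq.mpr h.symm]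

theorem pushTo_apply_of_lt {n : ℕ} {i j p : Fin n} (hp : p < i) (σ : Perm (Fin n)) :
    pushTo i j σ p = σ p := by
  simp only [pushTo, Perm.mul_apply]
  rw [Perm.inv_eq_iff_eq.mpr (Fin.cycleIcc_of_lt hp).symm]

theorem pushTo_apply_of_gt {n : ℕ} {i j p : Fin n} (hp : j < p) (σ : Perm (Fin n)) :
    pushTo i j σ p = σ p := by
  simp only [pushTo, Perm.mul_apply]
  rw [Perm.inv_eq_iff_eq.mpr (Fin.cycleIcc_of_gt hp).symm]

/-- The set of push-to-the-top transitions `t_{↑j} = t_{1↑j}`, `1 < j ≤ n`, on `S_n`. -/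
def topTransitions (n : ℕ) : Set (Perm (Fin n) → Perm (Fin n)) :=
  {t | ∃ i j : Fin n, (i : ℕ) = 0 ∧ i < j ∧ t = pushTo i j}

/-- A `T`-Gray code of size `M` over `S`: a sequence `c_1, …, c_M` of distinct elements of `S`, each
of which (but the first) arises from the preceding one by a transition in `T`.  The element `c_r` is
`c ⟨r - 1, _⟩`. -/
def IsGrayCode {S : Type*} (T : Set (S → S)) {M : ℕ} (c : Fin M → S) : Prop :=
  Function.Injective c ∧
    ∀ (r : ℕ) (h : r + 1 < M), ∃ t ∈ T, c ⟨r + 1, h⟩ = t (c ⟨r, by omega⟩)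

/-- A cyclic `T`-Gray code: moreover `c_1 = t (c_M)` for some `t ∈ T`. -/
def IsCyclicGrayCode {S : Type*} (T : Set (S → S)) {M : ℕ} (c : Fin M → S) : Prop :=
  IsGrayCode T c ∧ ∃ h : 0 < M, ∃ t ∈ T, c ⟨0, h⟩ = t (c ⟨M - 1, by omega⟩)

/-- `c` is a `G_↑(n, M)`: a cyclic push-to-the-top Gray code of size `M` over `S_n`. -/
def IsTopCode {n M : ℕ} (c : Fin M → Perm (Fin n)) : Prop :=
  IsCyclicGrayCode (topTransitions n) c

/-- `c` is an auxiliary code `G^aux_↑(k, M)`: a `G_↑(k, M)` such that, for `q = 1, …, k - 1`,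
`σ ∈ C` implies `(q, k) ∘ σ ∉ C`.  Here `l` is the element that represents `k`. -/
def IsAuxCode {k M : ℕ} (c : Fin M → Perm (Fin k)) : Prop :=
  IsTopCode c ∧
    ∀ q l : Fin k, (l : ℕ) + 1 = k → q < l →
      ∀ σ ∈ Set.range c, swap q l * σ ∉ Set.range c

/-- The sequence `c` starts with `s` followed by the transition `t`: `c_1 = s`, `c_2 = t s`. -/
def StartsWith {S : Type*} {M : ℕ} (c : Fin M → S) (s : S) (t : S → S) : Prop :=
  ∃ h : 1 < M, c ⟨0, by omega⟩ = s ∧ c ⟨1, h⟩ = t s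

/-- The size `M̃_k` (for `k ≥ 3`), where the factor for even `k > 6` is `ρ k`. -/
noncomputable def auxSize (ρ : ℕ → ℝ) (k : ℕ) : ℝ :=
  if k = 4 then 8
  else if k = 5 then 57
  else if k = 6 then 178
  else if Odd k then (k.factorial : ℝ) / 2
  else ρ k * ((k.factorial : ℝ) / 2)

end PushToTop

/-!
Words are written as lists of natural numbers and read from right to left: a push-to-the-top
transition then takes a letter other than the last one out of the word and appends it at the end
(`Step`).  The rotation of the word is the transition of the last index.  In a word of odd length,
moving the first, third or fifth letter to the end is an even permutation.

*Odd `k ≥ 7`.*  The code runs through all even words, which suffices because a transposition of two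
letters makes an even word odd.  Its existence is a theorem of Holroyd.  Rotating every word
decomposes the even words into cycles, one for each even cyclic order (`necklace`).  At the three
words `abc…`, `cab…`, `bca…` one may permute the successors, which amounts to moving the third
letter instead of the first, and if the three lie in different cycles, these are joined to one
(`Connected.join`).  It remains to find a spanning hypertree for these triples.  Cutting the
necklaces open at a fixed letter and splitting the resulting words by one letter after the other, one
finds inductively a tree through all even words but one, which can be chosen at will
(`connected_of_hub`, `connected_evenWords_diff`).  The last one is out of reach by parity, as a
triple reduces the number of cycles by two.  For at least seven letters the fifth letter can be used
as well, and six words whose successors can be permuted cyclically make up for the parity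
(`connected_link`); starting from this link, the induction yields all even words
(`connected_evenWords`, `hasTour_factorial`).  For `k = 5` a cycle through 57 even words is given
explicitly.

*Even `k`.*  Let `K` be the distinguished letter, and fix a letter `c ≠ K` (`exists_hub_path`,
`exists_isWordCode_even`).  The words `c u`, for the rotations `u` of a fixed word, arise from one
another by two rotations of the entire word with a detour between them through the class of the words
that begin with the first letter of `u`; this detour may be an entire tour for `k - 1` letters.  All
these tours have the same parity, opposite to that of the words `c u`, so that no two words of a
class are neighbours.  The detour for the last letter, in which `K` stays in second place, and a
single word that begins with `K` close up the code.  The classes of `K`, of `c` and of the last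
letter are thus sacrificed, and more than `(k - 3) (k - 1)! / 2` words are obtained.
-/

namespace PushToTop

/-! ### Parity of words -/

/-- The number of inversions of a word: pairs of positions whose letters are in decreasing order. -/
def inversions : List ℕ → ℕ
  | [] => 0
  | a :: l => l.countP (· < a) + inversions l

theorem inversions_swap (x : List ℕ) {a b : ℕ} (y : List ℕ) (h : a ≠ b) :
    (inversions (x ++ a :: b :: y) + inversions (x ++ b :: a :: y)) % 2 = 1 := by
  induction x with
  | nil =>
    simp only [List.nil_append, inversions, List.countP_cons, decide_eq_true_eq]
    rcases lt_or_gt_of_ne h with h | h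
    · rw [if_neg (by omega), if_pos h]; omega
    · rw [if_pos h, if_neg (by omega)]; omega
  | cons c x ih =>
    have hp : (x ++ a :: b :: y).countP (· < c) = (x ++ b :: a :: y).countP (· < c) :=
      ((List.Perm.swap b a y).append_left x).countP_eq _
    simp only [List.cons_append, inversions, hp]
    omega

/-- A function on words whose parity changes with each exchange of two adjacent, distinct
letters. -/
def Alternating (F : List ℕ → ℕ) : Prop :=
  ∀ (x : List ℕ) (a b : ℕ) (y : List ℕ), a ≠ b →
    (F (x ++ a :: b :: y) + F (x ++ b :: a :: y)) % 2 = 1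

theorem alternating_inversions : Alternating inversions := fun x _ _ y h => inversions_swap x y h

theorem Alternating.append_left {F : List ℕ → ℕ} (hF : Alternating F) (pre : List ℕ) :
    Alternating fun u => F (pre ++ u) := fun x a b y h => by
  simpa using hF (pre ++ x) a b y h

theorem Alternating.comp_map {F : List ℕ → ℕ} (hF : Alternating F) {φ : ℕ → ℕ}
    (hφ : Function.Injective φ) : Alternating fun u => F (u.map φ) := fun x a b y h => by
  simpa using hF (x.map φ) (φ a) (φ b) (y.map φ) (hφ.ne h)

/-- Any two alternating functions change their parity simultaneously, since any rearrangement is a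
sequence of exchanges of adjacent letters. -/
theorem Alternating.parity {F G : List ℕ → ℕ} (hF : Alternating F) (hG : Alternating G)
    {u v : List ℕ} (h : u.Perm v) (hu : u.Nodup) : (F u + F v + G u + G v) % 2 = 0 := by
  induction h generalizing F G with
  | nil => omega
  | cons a _ ih => exact ih (hF.append_left [a]) (hG.append_left [a]) (List.nodup_cons.1 hu).2
  | swap a b l =>
    have hab : b ≠ a := by
      rintro rfl
      simp at hu
    have h1 := hF [] b a l hab
    have h2 := hG [] b a l hab
    simp only [List.nil_append] at h1 h2
    omega
  | trans h₁ _ ih₁ ih₂ =>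
    have h1 := ih₁ hF hG hu
    have h2 := ih₂ hF hG (h₁.nodup_iff.1 hu)
    omega

/-- `v` is a rearrangement of `u` by an even permutation. -/
def EvenPerm (u v : List ℕ) : Prop := u.Perm v ∧ inversions u % 2 = inversions v % 2

instance (u v : List ℕ) : Decidable (EvenPerm u v) := inferInstanceAs (Decidable (_ ∧ _))

namespace EvenPerm

theorem refl (u : List ℕ) : EvenPerm u u := ⟨List.Perm.refl u, rfl⟩

theorem symm {u v : List ℕ} (h : EvenPerm u v) : EvenPerm v u := ⟨h.1.symm, h.2.symm⟩

theorem trans {u v w : List ℕ} (h : EvenPerm u v) (h' : EvenPerm v w) : EvenPerm u w :=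
  ⟨h.1.trans h'.1, h.2.trans h'.2⟩

theorem nodup_iff {u v : List ℕ} (h : EvenPerm u v) : u.Nodup ↔ v.Nodup := h.1.nodup_iff

theorem length_eq {u v : List ℕ} (h : EvenPerm u v) : u.length = v.length := h.1.length_eq

theorem append_left_iff {u v : List ℕ} (hu : u.Nodup) (pre : List ℕ) :
    EvenPerm (pre ++ u) (pre ++ v) ↔ EvenPerm u v := by
  unfold EvenPerm
  rw [List.perm_append_left_iff]
  refine and_congr_right fun h => ?_
  have := alternating_inversions.parity (alternating_inversions.append_left pre) h hu
  omega

theorem cons_iff {u v : List ℕ} (hu : u.Nodup) (a : ℕ) :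
    EvenPerm (a :: u) (a :: v) ↔ EvenPerm u v := append_left_iff hu [a]

theorem map_iff {u v : List ℕ} (hu : u.Nodup) {φ : ℕ → ℕ} (hφ : Function.Injective φ) :
    EvenPerm (u.map φ) (v.map φ) ↔ EvenPerm u v := by
  unfold EvenPerm
  rw [List.map_perm_map_iff hφ]
  refine and_congr_right fun h => ?_
  have := alternating_inversions.parity (alternating_inversions.comp_map hφ) h hu
  omega

theorem rotate_three (x : List ℕ) {a b c : ℕ} (y : List ℕ) (hac : a ≠ c) (hbc : b ≠ c) :
    EvenPerm (x ++ a :: b :: c :: y) (x ++ c :: a :: b :: y) := by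
  refine ⟨List.Perm.append_left x ?_, ?_⟩
  · exact ((List.Perm.swap c b y).cons a).trans (List.Perm.swap c a _)
  · have h1 := inversions_swap (x ++ [a]) y hbc
    have h2 := inversions_swap x (b :: y) hac
    simp only [List.append_assoc, List.cons_append, List.nil_append] at h1
    omega

end EvenPerm

theorem inversions_append_singleton {a : ℕ} {l : List ℕ} (h : a ∉ l) :
    (inversions (l ++ [a]) + inversions (a :: l) + l.length) % 2 = 0 := by
  induction l with
  | nil => simp [inversions]
  | cons b l ih =>
    simp only [List.mem_cons, not_or] at h
    have h1 := ih h.2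
    have h2 := inversions_swap [] l h.1
    have h3 : (l ++ [a]).countP (· < b) = (a :: l).countP (· < b) :=
      (List.perm_append_singleton a l).countP_eq _
    simp only [List.nil_append, inversions, List.cons_append, List.length_cons] at h1 h2 h3 ⊢
    omega

theorem evenPerm_append_singleton {a : ℕ} {l : List ℕ} (h : a ∉ l) (hl : Even l.length) :
    EvenPerm (l ++ [a]) (a :: l) := by
  refine ⟨List.perm_append_singleton a l, ?_⟩
  have := inversions_append_singleton h
  obtain ⟨r, hr⟩ := hl
  omega

/-- The transposition of two letters changes the parity of a word. -/
theorem inversions_map_swap {w : List ℕ} (hw : w.Nodup) {a b : ℕ} (ha : a ∈ w) (hb : b ∈ w)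
    (hab : a ≠ b) : (inversions w + inversions (w.map (swap a b))) % 2 = 1 := by
  have hp : w.Perm (a :: b :: (w.erase a).erase b) :=
    (List.perm_cons_erase ha).trans
      ((List.perm_cons_erase ((List.mem_erase_of_ne hab.symm).2 hb)).cons a)
  have h1 := alternating_inversions.parity
    (alternating_inversions.comp_map (swap a b).injective) hp hw
  have hn := hp.nodup_iff.1 hw
  have h2 : ((w.erase a).erase b).map (swap a b) = (w.erase a).erase b := by
    obtain ⟨h₁, h₂, -⟩ : a ∉ (w.erase a).erase b ∧ b ∉ (w.erase a).erase b ∧ True := by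
      simp only [List.nodup_cons, List.mem_cons, not_or] at hn
      exact ⟨hn.1.2, hn.2.1, trivial⟩
    refine (List.map_congr_left fun c hc => ?_).trans (List.map_id _)
    exact swap_apply_of_ne_of_ne (fun h => h₁ (h ▸ hc)) (fun h => h₂ (h ▸ hc))
  have h3 := inversions_swap [] ((w.erase a).erase b) hab
  simp only [List.map_cons, h2, swap_apply_left, swap_apply_right, List.nil_append] at h1 h3
  omega

/-- Every word with distinct letters is a relabelling of `0 1 … n-1`. -/
theorem exists_injective_map_range {u : List ℕ} (hu : u.Nodup) :
    ∃ φ : ℕ → ℕ, Function.Injective φ ∧ u = (List.range u.length).map φ := by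
  refine ⟨fun i => if h : i < u.length then u[i] else u.sum + 1 + i, ?_, ?_⟩
  · have hs : ∀ i (h : i < u.length), u[i] ≤ u.sum := fun i h =>
      List.le_sum_of_mem (List.getElem_mem h)
    intro i j hij
    by_cases hi : i < u.length <;> by_cases hj : j < u.length <;>
      simp only [hi, hj, dif_pos, dif_neg, not_false_eq_true] at hij
    · exact (hu.getElem_inj_iff).1 hij
    · have := hs i hi; omega
    · have := hs j hj; omega
    · omega
  · apply List.ext_getElem <;> simp
    intro i h; simp [h]

/-! ### Steps -/

/-- One word arises from another by moving a letter that is not the last one to the end.  In the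
vector notation read from right to left this is a push-to-the-top transition. -/
def Step (u v : List ℕ) : Prop :=
  ∃ (x : List ℕ) (a : ℕ) (y : List ℕ), y ≠ [] ∧ u = x ++ a :: y ∧ v = x ++ y ++ [a]

theorem Step.cons {u v : List ℕ} (h : Step u v) (c : ℕ) : Step (c :: u) (c :: v) := by
  obtain ⟨x, a, y, hy, rfl, rfl⟩ := h
  exact ⟨c :: x, a, y, hy, rfl, rfl⟩

theorem Step.map {u v : List ℕ} (h : Step u v) (φ : ℕ → ℕ) : Step (u.map φ) (v.map φ) := by
  obtain ⟨x, a, y, hy, rfl, rfl⟩ := h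
  exact ⟨x.map φ, φ a, y.map φ, by simpa using hy, by simp, by simp⟩

theorem step_rotate (a : ℕ) {l : List ℕ} (hl : l ≠ []) : Step (a :: l) (l ++ [a]) :=
  ⟨[], a, l, hl, rfl, rfl⟩

/-! ### Merging cycles -/

/-- `b` is reached from `a` by iterating `g`. -/
def Reach {α : Type*} (g : α → α) (a b : α) : Prop := ∃ i : ℕ, g^[i] a = b

theorem Reach.refl {α : Type*} (g : α → α) (a : α) : Reach g a a := ⟨0, rfl⟩

theorem Reach.step {α : Type*} (g : α → α) (a : α) : Reach g a (g a) := ⟨1, rfl⟩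

theorem Reach.trans {α : Type*} {g : α → α} {a b c : α} (h : Reach g a b) (h' : Reach g b c) :
    Reach g a c := by
  obtain ⟨i, rfl⟩ := h
  obtain ⟨j, rfl⟩ := h'
  exact ⟨j + i, Function.iterate_add_apply g j i a⟩

/-- `S` is a single cycle of `g`. -/
def Cyc {α : Type*} (g : α → α) (S : Set α) : Prop :=
  (∀ a ∈ S, g a ∈ S) ∧ ∀ a ∈ S, ∀ b ∈ S, Reach g a b

theorem Cyc.iterate_mem {α : Type*} {g : α → α} {S : Set α} (h : Cyc g S) {a : α} (ha : a ∈ S)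
    (i : ℕ) : g^[i] a ∈ S := by
  induction i with
  | zero => exact ha
  | succ i ih => rw [Function.iterate_succ_apply']; exact h.1 _ ih

/-- A function that agrees with `g` on a cycle `S` except at `x` still leads from everywhere in `S`
to `x`. -/
theorem Cyc.reach_to {α : Type*} {g g' : α → α} {S : Set α} (h : Cyc g S) {x : α} (hx : x ∈ S)
    (hg : ∀ a ∈ S, a ≠ x → g' a = g a) {a : α} (ha : a ∈ S) : Reach g' a x := by
  obtain ⟨i, hi⟩ := h.2 a ha x hx
  induction i generalizing a with
  | zero => exact hi ▸ Reach.refl g' a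
  | succ i ih =>
    by_cases hax : a = x
    · exact hax ▸ Reach.refl g' a
    · exact (hg a ha hax ▸ Reach.step g' a).trans (ih (h.1 a ha) hi)

/-- A function that agrees with `g` on a cycle `S` except at `x` still leads from `g x` to
everywhere in `S`: a shortest path from `g x` need not leave `x`. -/
theorem Cyc.reach_from {α : Type*} {g g' : α → α} {S : Set α} (h : Cyc g S) {x : α} (hx : x ∈ S)
    (hg : ∀ a ∈ S, a ≠ x → g' a = g a) {b : α} (hb : b ∈ S) : Reach g' (g x) b := by
  classical
  have hex : ∃ i, g^[i] (g x) = b := h.2 _ (h.1 x hx) b hb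
  have key : ∀ j ≤ Nat.find hex, g'^[j] (g x) = g^[j] (g x) := by
    intro j
    induction j with
    | zero => intro _; rfl
    | succ j ih =>
      intro hj
      rw [Function.iterate_succ_apply', Function.iterate_succ_apply', ih (by omega)]
      refine hg _ (h.iterate_mem (h.1 x hx) j) fun hjx => ?_
      refine Nat.find_min hex (m := Nat.find hex - (j + 1)) (by omega) ?_
      have := Nat.find_spec hex
      rw [show Nat.find hex = Nat.find hex - (j + 1) + (j + 1) by omega,
        Function.iterate_add_apply, Function.iterate_succ_apply', hjx] at this
      exact this
  exact ⟨Nat.find hex, (key _ le_rfl).trans (Nat.find_spec hex)⟩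

open scoped Fin.NatCast in
/-- Disjoint cycles become one when the successors of one chosen point in each of them are permuted
cyclically. -/
theorem Cyc.merge {α : Type*} {m : ℕ} {S : Fin (m + 1) → Set α} {g : Fin (m + 1) → α → α}
    {x : Fin (m + 1) → α} {g' : α → α} (h : ∀ i, Cyc (g i) (S i)) (hx : ∀ i, x i ∈ S i)
    (hg : ∀ i, ∀ a ∈ S i, a ≠ x i → g' a = g i a)
    (hgx : ∀ i, g' (x i) = g (i + 1) (x (i + 1))) : Cyc g' (⋃ i, S i) := by
  have hstep : ∀ i, Reach g' (x i) (x (i + 1)) := fun i =>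
    (Reach.step g' (x i)).trans (hgx i ▸
      (h (i + 1)).reach_to (hx _) (hg _) ((h (i + 1)).1 _ (hx _)))
  have hnat : ∀ (k : ℕ) (i : Fin (m + 1)), Reach g' (x i) (x (i + (k : Fin (m + 1)))) := by
    intro k
    induction k with
    | zero => intro i; simpa using Reach.refl g' (x i)
    | succ k ih =>
      intro i
      have := (ih i).trans (hstep _)
      rwa [add_assoc, ← Nat.cast_succ] at this
  have hall : ∀ i j, Reach g' (x i) (x j) := by
    intro i j
    have := hnat ((j - i : Fin (m + 1)) : ℕ) i
    rwa [Fin.cast_val_eq_self, add_sub_cancel] at this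
  refine ⟨fun a ha => ?_, fun a ha b hb => ?_⟩
  · obtain ⟨i, hi⟩ := Set.mem_iUnion.1 ha
    by_cases hax : a = x i
    · exact Set.mem_iUnion.2 ⟨i + 1, by rw [hax, hgx]; exact (h _).1 _ (hx _)⟩
    · exact Set.mem_iUnion.2 ⟨i, by rw [hg i a hi hax]; exact (h _).1 _ hi⟩
  · obtain ⟨i, hi⟩ := Set.mem_iUnion.1 ha
    obtain ⟨j, hj⟩ := Set.mem_iUnion.1 hb
    have h1 : Reach g' a (x i) := (h i).reach_to (hx i) (hg i) hi
    have h2 : Reach g' (x (j - 1)) (g j (x j)) := by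
      have := Reach.step g' (x (j - 1))
      rwa [hgx, sub_add_cancel] at this
    exact (h1.trans (hall i (j - 1))).trans (h2.trans ((h j).reach_from (hx j) (hg j) hj))

/-! ### Necklaces -/

/-- The rotation of the pointed words.  The pair `(x, y)` stands for the word `y * x`, where `*` is
an additional letter; the words that arise from one another by rotation are those with the same
`x ++ y`. -/
def rot : List ℕ × List ℕ → List ℕ × List ℕ
  | (x, []) => ([], x)
  | (x, b :: y) => (x ++ [b], y)

/-- The necklace of a pointed word: the letters that follow `*` in cyclic order. -/
def necklace (p : List ℕ × List ℕ) : List ℕ := p.1 ++ p.2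

theorem necklace_rot (p : List ℕ × List ℕ) : necklace (rot p) = necklace p := by
  obtain ⟨x, _ | ⟨b, y⟩⟩ := p <;> simp [rot, necklace]

/-- The transitions that move the first, the third or the fifth letter to the end of a pointed
word, where the third and the fifth letter are moved only from before `*`. -/
inductive Move : List ℕ × List ℕ → List ℕ × List ℕ → Prop
  | one (p) : Move p (rot p)
  | three (x a b c y) : Move (x, a :: b :: c :: y) (x ++ [c], a :: b :: y)
  | five (x a b c d e y) : Move (x, a :: b :: c :: d :: e :: y) (x ++ [e], a :: b :: c :: d :: y)

/-- `g` is a choice of moves for which the pointed words with necklace in `S` form a single cycle.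
Outside of the exceptional set `Sp`, a move other than the rotation is used at `(x, abcy)` only if
the two further necklaces `x cab y`, `x bca y` lie in `S` too; hence these three words are still
rotated as long as their necklaces lie in different sets of this kind. -/
structure IsCover (Sp : Set (List ℕ × List ℕ)) (S : Set (List ℕ))
    (g : List ℕ × List ℕ → List ℕ × List ℕ) : Prop where
  move : ∀ p, necklace p ∈ S → Move p (g p)
  triple : ∀ x a b c y, x ++ a :: b :: c :: y ∈ S → (x, a :: b :: c :: y) ∉ Sp →
    g (x, a :: b :: c :: y) ≠ rot (x, a :: b :: c :: y) →
    x ++ c :: a :: b :: y ∈ S ∧ x ++ b :: c :: a :: y ∈ S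
  cyc : Cyc g {p | necklace p ∈ S}

/-- The pointed words with necklace in `S` can be joined to a single cycle. -/
def Connected (Sp : Set (List ℕ × List ℕ)) (S : Set (List ℕ)) : Prop := ∃ g, IsCover Sp S g

theorem cyc_rot (l : List ℕ) : Cyc rot {p | necklace p = l} := by
  have h1 : ∀ y x, Reach rot (x, y) ([], x ++ y) := by
    intro y
    induction y with
    | nil => intro x; simpa [rot] using Reach.step rot (x, [])
    | cons b y ih =>
      intro x
      simpa using (Reach.step rot (x, b :: y)).trans (ih (x ++ [b]))
  have h2 : ∀ x y z, Reach rot (z, x ++ y) (z ++ x, y) := by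
    intro x
    induction x with
    | nil => intro y z; simpa using Reach.refl rot (z, y)
    | cons b x ih =>
      intro y z
      simpa using (Reach.step rot (z, b :: (x ++ y))).trans (ih y (z ++ [b]))
  refine ⟨fun p hp => (necklace_rot p).trans hp, ?_⟩
  rintro ⟨x, y⟩ rfl ⟨x', y'⟩ h
  have h3 := h1 y x
  have h4 := h2 x' y' []
  change x' ++ y' = x ++ y at h
  rw [h, List.nil_append] at h4
  exact h3.trans h4

theorem connected_singleton (Sp : Set (List ℕ × List ℕ)) (l : List ℕ) : Connected Sp {l} :=
  ⟨rot, fun p _ => .one p, fun _ _ _ _ _ _ _ h => absurd rfl h, cyc_rot l⟩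

/-- Three connected sets of necklaces are joined by three necklaces that differ by a rotation of
three consecutive letters: the successors of `abc…`, `cab…` and `bca…` are permuted. -/
theorem Connected.join {Sp : Set (List ℕ × List ℕ)} {S₁ S₂ S₃ : Set (List ℕ)}
    (h₁ : Connected Sp S₁) (h₂ : Connected Sp S₂) (h₃ : Connected Sp S₃)
    (h₁₂ : Disjoint S₁ S₂) (h₁₃ : Disjoint S₁ S₃) (h₂₃ : Disjoint S₂ S₃) {x y : List ℕ} {a b c : ℕ}
    (m₁ : x ++ a :: b :: c :: y ∈ S₁) (m₂ : x ++ c :: a :: b :: y ∈ S₂)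
    (m₃ : x ++ b :: c :: a :: y ∈ S₃) (n₁ : (x, a :: b :: c :: y) ∉ Sp)
    (n₂ : (x, c :: a :: b :: y) ∉ Sp) (n₃ : (x, b :: c :: a :: y) ∉ Sp) :
    Connected Sp (S₁ ∪ S₂ ∪ S₃) := by
  classical
  obtain ⟨g₁, H₁⟩ := h₁
  obtain ⟨g₂, H₂⟩ := h₂
  obtain ⟨g₃, H₃⟩ := h₃
  have d₁₂ : ∀ {l}, l ∈ S₁ → l ∉ S₂ := fun h h' => Set.disjoint_left.1 h₁₂ h h'
  have d₁₃ : ∀ {l}, l ∈ S₁ → l ∉ S₃ := fun h h' => Set.disjoint_left.1 h₁₃ h h'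
  have d₂₃ : ∀ {l}, l ∈ S₂ → l ∉ S₃ := fun h h' => Set.disjoint_left.1 h₂₃ h h'
  have e₁ : g₁ (x, a :: b :: c :: y) = rot (x, a :: b :: c :: y) := by
    by_contra h
    exact d₁₂ (H₁.triple _ _ _ _ _ m₁ n₁ h).1 m₂
  have e₂ : g₂ (x, c :: a :: b :: y) = rot (x, c :: a :: b :: y) := by
    by_contra h
    exact d₁₂ m₁ (by simpa using (H₂.triple _ _ _ _ _ m₂ n₂ h).2)
  have e₃ : g₃ (x, b :: c :: a :: y) = rot (x, b :: c :: a :: y) := by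
    by_contra h
    exact d₁₃ m₁ (by simpa using (H₃.triple _ _ _ _ _ m₃ n₃ h).1)
  have r₁₂ : ((x, a :: b :: c :: y) : List ℕ × List ℕ) ≠ (x, c :: a :: b :: y) := fun h =>
    d₁₂ m₁ (by rw [Prod.mk.injEq] at h; rw [h.2]; exact m₂)
  have r₁₃ : ((x, a :: b :: c :: y) : List ℕ × List ℕ) ≠ (x, b :: c :: a :: y) := fun h =>
    d₁₃ m₁ (by rw [Prod.mk.injEq] at h; rw [h.2]; exact m₃)
  have r₂₃ : ((x, c :: a :: b :: y) : List ℕ × List ℕ) ≠ (x, b :: c :: a :: y) := fun h =>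
    d₂₃ m₂ (by rw [Prod.mk.injEq] at h; rw [h.2]; exact m₃)
  let g' : List ℕ × List ℕ → List ℕ × List ℕ := fun p =>
    if p = (x, a :: b :: c :: y) then rot (x, c :: a :: b :: y)
    else if p = (x, c :: a :: b :: y) then rot (x, b :: c :: a :: y)
    else if p = (x, b :: c :: a :: y) then rot (x, a :: b :: c :: y)
    else if necklace p ∈ S₁ then g₁ p else if necklace p ∈ S₂ then g₂ p else g₃ p
  have v₁ : g' (x, a :: b :: c :: y) = rot (x, c :: a :: b :: y) := if_pos rfl
  have v₂ : g' (x, c :: a :: b :: y) = rot (x, b :: c :: a :: y) := by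
    simp only [g', if_neg r₁₂.symm, if_true]
  have v₃ : g' (x, b :: c :: a :: y) = rot (x, a :: b :: c :: y) := by
    simp only [g', if_neg r₁₃.symm, if_neg r₂₃.symm, if_true]
  have w : ∀ p, p ≠ (x, a :: b :: c :: y) → p ≠ (x, c :: a :: b :: y) →
      p ≠ (x, b :: c :: a :: y) →
      g' p = if necklace p ∈ S₁ then g₁ p else if necklace p ∈ S₂ then g₂ p else g₃ p :=
    fun p h h' h'' => by simp only [g', if_neg h, if_neg h', if_neg h'']
  have w₁ : ∀ p, necklace p ∈ S₁ → p ≠ (x, a :: b :: c :: y) → g' p = g₁ p := by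
    intro p hp hne
    rw [w p hne _ _, if_pos hp]
    · rintro rfl; exact d₁₂ hp m₂
    · rintro rfl; exact d₁₃ hp m₃
  have w₂ : ∀ p, necklace p ∈ S₂ → p ≠ (x, c :: a :: b :: y) → g' p = g₂ p := by
    intro p hp hne
    rw [w p _ hne _, if_neg fun h => d₁₂ h hp, if_pos hp]
    · rintro rfl; exact d₁₂ m₁ hp
    · rintro rfl; exact d₂₃ hp m₃
  have w₃ : ∀ p, necklace p ∈ S₃ → p ≠ (x, b :: c :: a :: y) → g' p = g₃ p := by
    intro p hp hne
    rw [w p _ _ hne, if_neg fun h => d₁₃ h hp, if_neg fun h => d₂₃ h hp]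
    · rintro rfl; exact d₁₃ m₁ hp
    · rintro rfl; exact d₂₃ m₂ hp
  refine ⟨g', ⟨fun p hp => ?_, fun x' a' b' c' y' hm hs hr => ?_, ?_⟩⟩
  · by_cases p₁ : p = (x, a :: b :: c :: y)
    · rw [p₁, v₁]; exact .three _ _ _ _ _
    by_cases p₂ : p = (x, c :: a :: b :: y)
    · rw [p₂, v₂]; exact .three _ _ _ _ _
    by_cases p₃ : p = (x, b :: c :: a :: y)
    · rw [p₃, v₃]; exact .three _ _ _ _ _
    rcases hp with (hp | hp) | hp
    · rw [w₁ p hp p₁]; exact H₁.move p hp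
    · rw [w₂ p hp p₂]; exact H₂.move p hp
    · rw [w₃ p hp p₃]; exact H₃.move p hp
  · have all : ∀ {l}, l ∈ S₁ ∨ l ∈ S₂ ∨ l ∈ S₃ → l ∈ S₁ ∪ S₂ ∪ S₃ := by
      rintro l (h | h | h)
      exacts [.inl (.inl h), .inl (.inr h), .inr h]
    by_cases p₁ : ((x', a' :: b' :: c' :: y') : List ℕ × List ℕ) = (x, a :: b :: c :: y)
    · simp only [Prod.mk.injEq, List.cons.injEq] at p₁
      obtain ⟨rfl, rfl, rfl, rfl, rfl⟩ := p₁
      exact ⟨all (.inr (.inl m₂)), all (.inr (.inr m₃))⟩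
    by_cases p₂ : ((x', a' :: b' :: c' :: y') : List ℕ × List ℕ) = (x, c :: a :: b :: y)
    · simp only [Prod.mk.injEq, List.cons.injEq] at p₂
      obtain ⟨rfl, rfl, rfl, rfl, rfl⟩ := p₂
      exact ⟨all (.inr (.inr m₃)), all (.inl m₁)⟩
    by_cases p₃ : ((x', a' :: b' :: c' :: y') : List ℕ × List ℕ) = (x, b :: c :: a :: y)
    · simp only [Prod.mk.injEq, List.cons.injEq] at p₃
      obtain ⟨rfl, rfl, rfl, rfl, rfl⟩ := p₃
      exact ⟨all (.inl m₁), all (.inr (.inl m₂))⟩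
    rcases hm with (hp | hp) | hp
    · rw [w₁ (x', _) hp p₁] at hr
      have := H₁.triple _ _ _ _ _ hp hs hr
      exact ⟨all (.inl this.1), all (.inl this.2)⟩
    · rw [w₂ (x', _) hp p₂] at hr
      have := H₂.triple _ _ _ _ _ hp hs hr
      exact ⟨all (.inr (.inl this.1)), all (.inr (.inl this.2))⟩
    · rw [w₃ (x', _) hp p₃] at hr
      have := H₃.triple _ _ _ _ _ hp hs hr
      exact ⟨all (.inr (.inr this.1)), all (.inr (.inr this.2))⟩
  · have := Cyc.merge (m := 2) (g' := g')
      (S := ![{p | necklace p ∈ S₁}, {p | necklace p ∈ S₂}, {p | necklace p ∈ S₃}])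
      (g := ![g₁, g₂, g₃])
      (x := ![(x, a :: b :: c :: y), (x, c :: a :: b :: y), (x, b :: c :: a :: y)])
      (by intro i; fin_cases i; exacts [H₁.cyc, H₂.cyc, H₃.cyc])
      (by intro i; fin_cases i; exacts [m₁, m₂, m₃])
      (by intro i; fin_cases i; exacts [w₁, w₂, w₃])
      (by
        intro i; fin_cases i
        exacts [v₁.trans e₂.symm, v₂.trans e₃.symm, v₃.trans e₁.symm])
    convert this using 1
    ext p
    simp [Fin.exists_fin_succ, or_assoc]

/-! ### Joining the classes of words -/

/-- The words `pre ++ v`, where `v` is an even rearrangement of `u`. -/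
def evenWords (pre u : List ℕ) : Set (List ℕ) := {l | ∃ v, EvenPerm v u ∧ l = pre ++ v}

theorem exists_evenPerm_cons {u : List ℕ} (hu : u.Nodup) {a b c : ℕ} (ha : a ∈ u) (hb : b ∈ u)
    (hc : c ∈ u) (hab : a ≠ b) (hac : a ≠ c) (hbc : b ≠ c) (hl : 5 ≤ u.length) :
    ∃ y, EvenPerm (a :: b :: c :: y) u := by
  have hp : u.Perm (a :: b :: c :: ((u.erase a).erase b).erase c) :=
    (List.perm_cons_erase ha).trans (((List.perm_cons_erase
      ((List.mem_erase_of_ne hab.symm).2 hb)).trans ((List.perm_cons_erase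
      ((List.mem_erase_of_ne hbc.symm).2 ((List.mem_erase_of_ne hac.symm).2 hc))).cons b)).cons a)
  generalize ((u.erase a).erase b).erase c = r at hp
  obtain _ | ⟨d, _ | ⟨e, y⟩⟩ := r
  · have := hp.length_eq; simp at this; omega
  · have := hp.length_eq; simp at this; omega
  · have hn := hp.nodup_iff.1 hu
    have hde : d ≠ e := by
      rintro rfl
      simp at hn
    have h1 := inversions_swap [a, b, c] y hde
    simp only [List.cons_append, List.nil_append] at h1
    by_cases h : inversions (a :: b :: c :: d :: e :: y) % 2 = inversions u % 2
    · exact ⟨_, hp.symm, h⟩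
    · refine ⟨e :: d :: y, (List.Perm.trans ?_ hp.symm), by omega⟩
      exact (((List.Perm.swap d e y).cons c).cons b).cons a

theorem evenWords_append_singleton {pre u v : List ℕ} {p : ℕ} (hu : u.Nodup)
    (h : EvenPerm (p :: v) u) : evenWords (pre ++ [p]) v =
      {l | ∃ w, l = pre ++ w ∧ EvenPerm w u ∧ w.head? = some p} := by
  have hv : (p :: v).Nodup := h.nodup_iff.2 hu
  have hv' := (List.nodup_cons.1 hv).2
  ext l
  constructor
  · rintro ⟨w, hw, rfl⟩
    refine ⟨p :: w, by simp, ?_, rfl⟩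
    exact ((EvenPerm.cons_iff (hw.nodup_iff.2 hv') p).2 hw).trans h
  · rintro ⟨w, rfl, hw, hh⟩
    obtain _ | ⟨q, w⟩ := w
    · simp at hh
    · obtain rfl : q = p := by simpa using hh
      have hn := (List.nodup_cons.1 (hw.nodup_iff.2 hu)).2
      exact ⟨w, (EvenPerm.cons_iff hn q).1 (hw.trans h.symm), by simp⟩

/-- The words with prefix `pre` are split by their next letter.  If each class is connected up to
the omission of one word, chosen at will, then the classes can be joined to the one of the letter
`o`: with the class of `t i` one joins the word omitted in the class of `t (i + 1)`. -/
theorem connected_of_hub {Sp : Set (List ℕ × List ℕ)} {pre u : List ℕ} {o : ℕ}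
    (hu : (o :: u).Nodup) (hl : 4 ≤ u.length) (hpre : ∀ y, (pre, y) ∉ Sp) {X : Set (List ℕ)}
    (hX : X ⊆ {pre ++ o :: u}) (hhub : Connected Sp (evenWords (pre ++ [o]) u \ X))
    (hcls : ∀ p ∈ u, ∀ v, EvenPerm (p :: v) (o :: u) →
      Connected Sp (evenWords (pre ++ [p]) v \ {pre ++ p :: v})) :
    Connected Sp (evenWords pre (o :: u) \ X) := by
  have hm : 0 < u.length := by omega
  obtain ⟨ho, hun⟩ := List.nodup_cons.1 hu
  let t : ℕ → ℕ := fun i => u[i % u.length]'(Nat.mod_lt _ hm)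
  have t_mem : ∀ i, t i ∈ u := fun i => List.getElem_mem _
  have t_ne : ∀ i, t i ≠ o := fun i h => ho (h ▸ t_mem i)
  have t_inj : ∀ i j, t i = t j → i % u.length = j % u.length := fun i j h =>
    (hun.getElem_inj_iff).1 h
  have t_add : ∀ i, t (i + u.length) = t i := fun i => by simp only [t, Nat.add_mod_right]
  have mod_of_lt : ∀ {i}, i < u.length → i % u.length = i := fun h => Nat.mod_eq_of_lt h
  have t_succ : ∀ i, t (i + 1) ≠ t i := by
    intro i h
    have h1 := t_inj _ _ h
    have hm2 : 1 < u.length := by omega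
    have h2 : (i + 1) % u.length = (i % u.length + 1) % u.length := by simp
    have h3 := Nat.mod_lt i hm
    rcases Nat.lt_or_ge (i % u.length + 1) u.length with h4 | h4
    · rw [mod_of_lt h4] at h2; omega
    · have h5 : i % u.length + 1 = u.length := by omega
      rw [h5, Nat.mod_self] at h2; omega
  have hY : ∀ p q, ∃ y, p ∈ u → q ∈ u → p ≠ q → EvenPerm (p :: q :: o :: y) (o :: u) := by
    intro p q
    by_cases h : p ∈ u ∧ q ∈ u ∧ p ≠ q
    · obtain ⟨y, hy⟩ := exists_evenPerm_cons hu (List.mem_cons_of_mem o h.1)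
        (List.mem_cons_of_mem o h.2.1) List.mem_cons_self h.2.2 (fun e => ho (e ▸ h.1))
        (fun e => ho (e ▸ h.2.1)) (by simpa using hl)
      exact ⟨y, fun _ _ _ => hy⟩
    · exact ⟨[], fun h1 h2 h3 => absurd ⟨h1, h2, h3⟩ h⟩
  choose Y hY using hY
  let W : ℕ → List ℕ := fun i => t (i + 1) :: t i :: o :: Y (t (i + 1)) (t i)
  have hW : ∀ i, EvenPerm (W i) (o :: u) := fun i =>
    hY _ _ (t_mem _) (t_mem _) (t_succ i)
  -- `L i` is the word omitted in the class of `t i`.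
  let L : ℕ → List ℕ := fun i => W (i + (u.length - 1))
  have L_succ : ∀ i, L (i + 1) = W i := by
    intro i
    have e : i + 1 + (u.length - 1) = i + u.length := by omega
    simp only [L, W, e, t_add, show i + u.length + 1 = i + 1 + u.length by omega]
  have L_zero : L 0 = W (u.length - 1) := by simp only [L, Nat.zero_add]
  have L_cons : ∀ i, ∃ z, L i = t i :: z := by
    intro i
    have e : t (i + (u.length - 1) + 1) = t i := by
      rw [show i + (u.length - 1) + 1 = i + u.length by omega, t_add]
    exact ⟨(L i).tail, by rw [← e]; rfl⟩
  -- After `k` joins, the class of `o`, those of `t 0, …, t (k - 1)` without the words `L i`, and the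
  -- words `W 0, …, W (k - 1)` are connected.
  let C : ℕ → List ℕ → Prop := fun k w => (w.head? = some o ∧ pre ++ w ∉ X) ∨
    (∃ i < k, w.head? = some (t i) ∧ w ≠ L i) ∨ ∃ i < k, w = W i
  let cur : ℕ → Set (List ℕ) := fun k => {l | ∃ w, l = pre ++ w ∧ EvenPerm w (o :: u) ∧ C k w}
  have hcur : ∀ k ≤ u.length, Connected Sp (cur k) := by
    intro k
    induction k with
    | zero =>
      intro _
      convert hhub using 1
      rw [evenWords_append_singleton hu (EvenPerm.refl _)]
      ext l
      constructor
      · rintro ⟨w, rfl, hw, ⟨h1, h2⟩ | ⟨i, hi, _⟩ | ⟨i, hi, _⟩⟩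
        · exact ⟨⟨w, rfl, hw, h1⟩, h2⟩
        · omega
        · omega
      · rintro ⟨⟨w, rfl, hw, h1⟩, h2⟩
        exact ⟨w, rfl, hw, .inl ⟨h1, h2⟩⟩
    | succ k ih =>
      intro hk
      have hkm : k % u.length = k := mod_of_lt (by omega)
      obtain ⟨z, hz⟩ := L_cons k
      have hLk : EvenPerm (t k :: z) (o :: u) := hz ▸ hW _
      have h2 := hcls (t k) (t_mem k) z hLk
      rw [evenWords_append_singleton hu hLk, ← hz] at h2
      have hWk := hW k
      have hn := hWk.nodup_iff.2 hu
      have hrot := EvenPerm.rotate_three [] (a := t (k + 1)) (b := t k) (c := o)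
        (Y (t (k + 1)) (t k)) (t_ne _) (t_ne _)
      have hrot' := EvenPerm.rotate_three [] (a := o) (b := t (k + 1)) (c := t k)
        (Y (t (k + 1)) (t k)) (t_ne _).symm (t_succ k)
      simp only [List.nil_append] at hrot hrot'
      have d₁₂ : Disjoint (cur k) ({l | ∃ w, l = pre ++ w ∧ EvenPerm w (o :: u) ∧
          w.head? = some (t k)} \ {pre ++ L k}) := by
        rw [Set.disjoint_left]
        rintro _ ⟨w, rfl, hw, hC⟩ ⟨⟨w', hww, hw', hh⟩, hne⟩
        obtain rfl : w = w' := List.append_cancel_left hww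
        rcases hC with ⟨h1, -⟩ | ⟨i, hi, h1, -⟩ | ⟨i, hi, rfl⟩
        · rw [h1, Option.some_inj] at hh
          exact t_ne k hh.symm
        · rw [h1, Option.some_inj] at hh
          have := t_inj _ _ hh
          rw [hkm, mod_of_lt (by omega)] at this
          omega
        · have h3 : t (i + 1) = t k := by simpa [W] using hh
          have := t_inj _ _ h3
          rw [hkm, mod_of_lt (by omega)] at this
          exact hne (by rw [← this, L_succ]; rfl)
      have d₁₃ : Disjoint (cur k) {pre ++ W k} := by
        rw [Set.disjoint_singleton_right]
        rintro ⟨w, hww, hw, hC⟩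
        obtain rfl : W k = w := List.append_cancel_left hww
        rcases hC with ⟨h1, -⟩ | ⟨i, hi, h1, h2⟩ | ⟨i, hi, h1⟩
        · exact t_ne (k + 1) (by simpa [W] using h1)
        · have h3 : t (k + 1) = t i := by simpa [W] using h1
          have h4 := t_inj _ _ h3
          rw [mod_of_lt (show i < u.length by omega)] at h4
          rcases Nat.lt_or_ge (k + 1) u.length with h5 | h5
          · rw [mod_of_lt h5] at h4; omega
          · have h6 : k + 1 = u.length := by omega
            rw [h6, Nat.mod_self] at h4
            refine h2 ?_
            rw [← h4, L_zero, ← h6, Nat.add_sub_cancel]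
        · have h3 : t k = t i := by
            simp only [W, List.cons.injEq] at h1
            exact h1.2.1
          have h4 := t_inj _ _ h3
          rw [hkm, mod_of_lt (by omega)] at h4
          omega
      have d₂₃ : Disjoint ({l | ∃ w, l = pre ++ w ∧ EvenPerm w (o :: u) ∧
          w.head? = some (t k)} \ {pre ++ L k}) {pre ++ W k} := by
        rw [Set.disjoint_singleton_right]
        rintro ⟨⟨w, hww, hw, hh⟩, -⟩
        obtain rfl : W k = w := List.append_cancel_left hww
        exact t_succ k (by simpa [W] using hh)
      have hj := (ih (by omega)).join h2 (connected_singleton Sp (pre ++ W k)) d₁₂ d₁₃ d₂₃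
        (x := pre) (a := o) (b := t (k + 1)) (c := t k) (y := Y (t (k + 1)) (t k))
        ⟨_, rfl, hrot.symm.trans hWk, .inl ⟨rfl, fun h => ?_⟩⟩
        ⟨⟨_, rfl, (hrot.trans hrot').symm.trans hWk, rfl⟩, fun h => ?_⟩ rfl
        (hpre _) (hpre _) (hpre _)
      · convert hj using 1
        ext l
        constructor
        · rintro ⟨w, rfl, hw, h1 | ⟨i, hi, h1, h3⟩ | ⟨i, hi, h1⟩⟩
          · exact .inl (.inl ⟨w, rfl, hw, .inl h1⟩)
          · rcases Nat.lt_succ_iff_lt_or_eq.1 hi with hi | rfl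
            · exact .inl (.inl ⟨w, rfl, hw, .inr (.inl ⟨i, hi, h1, h3⟩)⟩)
            · exact .inl (.inr ⟨⟨w, rfl, hw, h1⟩, fun h => h3 (List.append_cancel_left h)⟩)
          · rcases Nat.lt_succ_iff_lt_or_eq.1 hi with hi | rfl
            · exact .inl (.inl ⟨w, rfl, hw, .inr (.inr ⟨i, hi, h1⟩)⟩)
            · exact .inr (by rw [h1]; rfl)
        · rintro ((⟨w, rfl, hw, h1 | ⟨i, hi, h1⟩ | ⟨i, hi, h1⟩⟩ | ⟨⟨w, rfl, hw, h1⟩, h3⟩) | h1)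
          · exact ⟨w, rfl, hw, .inl h1⟩
          · exact ⟨w, rfl, hw, .inr (.inl ⟨i, by omega, h1⟩)⟩
          · exact ⟨w, rfl, hw, .inr (.inr ⟨i, by omega, h1⟩)⟩
          · exact ⟨w, rfl, hw, .inr (.inl ⟨k, by omega, h1, fun h => h3 (by rw [h]; rfl)⟩)⟩
          · exact ⟨W k, h1, hWk, .inr (.inr ⟨k, by omega, rfl⟩)⟩
      · -- The new word of the class of `o` is not `o :: u`, in which `t 1` follows `t 0`.
        have h3 := List.append_cancel_left (hX h)
        simp only [List.cons.injEq, true_and] at h3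
        have h4 : u[0] = t (k + 1) := by simp only [h3.symm, List.getElem_cons_zero]
        have h5 : u[1] = t k := by
          simp only [h3.symm, List.getElem_cons_zero, List.getElem_cons_succ]
        have h6 := (hun.getElem_inj_iff).1 h4
        have h7 := (hun.getElem_inj_iff).1 h5
        rw [hkm] at h7
        subst h7
        rw [mod_of_lt (by omega)] at h6
        omega
      · -- The new word of the class of `t k` differs from `L k` in the second letter.
        have h3 : t k :: o :: t (k + 1) :: Y (t (k + 1)) (t k) = L k := List.append_cancel_left h
        simp only [L, W, List.cons.injEq] at h3
        exact t_ne _ h3.2.1.symm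
  convert hcur u.length le_rfl using 1
  ext l
  constructor
  · rintro ⟨⟨w, hw, rfl⟩, hx⟩
    refine ⟨w, rfl, hw, ?_⟩
    obtain _ | ⟨q, w⟩ := w
    · have := hw.length_eq; simp at this
    have hq : q ∈ o :: u := hw.1.subset List.mem_cons_self
    rcases List.mem_cons.1 hq with rfl | hq
    · exact .inl ⟨rfl, hx⟩
    · obtain ⟨i, hi, rfl⟩ := List.getElem_of_mem hq
      have hti : u[i] = t i := by simp only [t, mod_of_lt hi]
      by_cases h : u[i] :: w = L i
      · refine .inr (.inr ?_)
        obtain _ | i := i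
        · exact ⟨u.length - 1, by omega, h.trans L_zero⟩
        · exact ⟨i, by omega, h.trans (L_succ i)⟩
      · exact .inr (.inl ⟨i, hi, by simp [hti], h⟩)
  · rintro ⟨w, rfl, hw, hC⟩
    refine ⟨⟨w, hw, rfl⟩, fun hx => ?_⟩
    have h1 := List.append_cancel_left (hX hx)
    subst h1
    rcases hC with ⟨-, h2⟩ | ⟨i, -, h2, -⟩ | ⟨i, -, h2⟩
    · exact h2 hx
    · exact t_ne i (by simpa using h2.symm)
    · simp only [W, List.cons.injEq] at h2
      exact t_ne _ h2.1.symm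

/-! ### Connectedness of the even words -/

/-- The word `w` with the three letters from position `i` on rotated to the right. -/
def turn (i : ℕ) (w : List ℕ) : List ℕ :=
  match w.drop i with
  | a :: b :: c :: y => w.take i ++ c :: a :: b :: y
  | _ => w

/-- The list `vis` of words, extended by the two that arise from `e.2` by rotating the three letters
from position `e.1` on. -/
def grow (vis : List (List ℕ)) (e : ℕ × List ℕ) : List (List ℕ) :=
  turn e.1 e.2 :: turn e.1 (turn e.1 e.2) :: vis

/-- Starting from the list `vis` one can perform the extensions `es` in turn, always from a word
that is present to two new ones, and without use of a word in `bad` for a rotation of the first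
three letters. -/
def Growable (bad : List (List ℕ)) : List (List ℕ) → List (ℕ × List ℕ) → Prop
  | _, [] => True
  | vis, e :: es => (e.1 + 3 ≤ e.2.length ∧ e.2 ∈ vis ∧ turn e.1 e.2 ∉ vis ∧
      turn e.1 (turn e.1 e.2) ∉ vis ∧ turn e.1 e.2 ≠ turn e.1 (turn e.1 e.2) ∧
      (e.1 = 0 → e.2 ∉ bad ∧ turn e.1 e.2 ∉ bad ∧ turn e.1 (turn e.1 e.2) ∉ bad)) ∧
    Growable bad (grow vis e) es

instance Growable.decidable (bad : List (List ℕ)) :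
    ∀ (vis : List (List ℕ)) (es : List (ℕ × List ℕ)), Decidable (Growable bad vis es)
  | _, [] => inferInstanceAs (Decidable True)
  | vis, e :: es =>
    have := Growable.decidable bad (grow vis e) es
    inferInstanceAs (Decidable (_ ∧ _))

theorem exists_turn {i : ℕ} {w : List ℕ} (h : i + 3 ≤ w.length) : ∃ x a b c y, x.length = i ∧
    w = x ++ a :: b :: c :: y ∧ turn i w = x ++ c :: a :: b :: y ∧
    turn i (x ++ c :: a :: b :: y) = x ++ b :: c :: a :: y := by
  have key : ∀ (x : List ℕ) a b c y,
      turn x.length (x ++ a :: b :: c :: y) = x ++ c :: a :: b :: y := by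
    intro x a b c y
    simp [turn]
  have hd : (w.drop i).length = w.length - i := List.length_drop
  rcases hw : w.drop i with _ | ⟨a, _ | ⟨b, _ | ⟨c, y⟩⟩⟩
  · simp [hw] at hd; omega
  · simp [hw] at hd; omega
  · simp [hw] at hd; omega
  · have hx : (w.take i).length = i := by simp; omega
    have hwx : w = w.take i ++ a :: b :: c :: y := by rw [← hw, List.take_append_drop]
    refine ⟨w.take i, a, b, c, y, hx, hwx, ?_⟩
    generalize w.take i = x at hx hwx
    subst hx hwx
    rw [key, key]
    exact ⟨rfl, rfl⟩

/-- Extensions of a connected list of words keep it connected, whatever the letters are (`φ`). -/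
theorem connected_grow {Sp : Set (List ℕ × List ℕ)} {pre : List ℕ} {φ : ℕ → ℕ}
    (hφ : Function.Injective φ) {bad : List (List ℕ)}
    (hSp : ∀ x z : List ℕ, (pre ++ x.map φ, z.map φ) ∈ Sp → x = [] ∧ z ∈ bad)
    (es : List (ℕ × List ℕ)) {vis : List (List ℕ)}
    (hvis : Connected Sp {l | ∃ w ∈ vis, l = pre ++ w.map φ}) (hg : Growable bad vis es) :
    Connected Sp {l | ∃ w ∈ es.foldl grow vis, l = pre ++ w.map φ} := by
  induction es generalizing vis with
  | nil => exact hvis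
  | cons e es ih =>
    obtain ⟨⟨h1, h2, h3, h4, h5, h6⟩, hg⟩ := hg
    refine ih ?_ hg
    obtain ⟨i, w⟩ := e
    obtain ⟨x, a, b, c, y, rfl, rfl, e1, e2⟩ := exists_turn h1
    simp only [grow, e1, e2] at h2 h3 h4 h5 h6 ⊢
    have hinj : ∀ {v v' : List ℕ}, pre ++ v.map φ = pre ++ v'.map φ → v = v' := fun h =>
      hφ.list_map (List.append_cancel_left h)
    have hb : ∀ z, (x.length = 0 → x ++ z ∉ bad) → (pre ++ x.map φ, z.map φ) ∉ Sp := by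
      intro z hz h
      obtain ⟨rfl, h'⟩ := hSp x z h
      exact hz rfl h'
    have hj := hvis.join (connected_singleton Sp (pre ++ (x ++ c :: a :: b :: y).map φ))
      (connected_singleton Sp (pre ++ (x ++ b :: c :: a :: y).map φ))
      (Set.disjoint_singleton_right.2 ?_) (Set.disjoint_singleton_right.2 ?_)
      (Set.disjoint_singleton_right.2 ?_) (x := pre ++ x.map φ) (a := φ a) (b := φ b) (c := φ c)
      (y := y.map φ) ⟨_, h2, by simp⟩ (by simp) (by simp)
      (hb (a :: b :: c :: y) fun h => (h6 h).1) (hb (c :: a :: b :: y) fun h => (h6 h).2.1)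
      (hb (b :: c :: a :: y) fun h => (h6 h).2.2)
    · convert hj using 1
      ext l
      simp only [Set.mem_ofPred_eq, List.mem_cons, Set.mem_union, Set.mem_singleton_iff]
      constructor
      · rintro ⟨w, rfl | rfl | hw, rfl⟩
        · exact .inl (.inr rfl)
        · exact .inr rfl
        · exact .inl (.inl ⟨w, hw, rfl⟩)
      · rintro ((⟨w, hw, rfl⟩ | rfl) | rfl)
        · exact ⟨w, .inr (.inr hw), rfl⟩
        · exact ⟨_, .inl rfl, rfl⟩
        · exact ⟨_, .inr (.inl rfl), rfl⟩
    · rintro ⟨w, hw, h⟩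
      exact h3 (hinj h ▸ hw)
    · rintro ⟨w, hw, h⟩
      exact h4 (hinj h ▸ hw)
    · exact fun h => h5 (hinj h).symm

theorem evenPerm_map_range_iff {φ : ℕ → ℕ} (hφ : Function.Injective φ) {n : ℕ} {v : List ℕ} :
    EvenPerm v ((List.range n).map φ) ↔
      ∃ w ∈ (List.range n).permutations', EvenPerm w (List.range n) ∧ v = w.map φ := by
  constructor
  · intro h
    obtain ⟨w, hw, rfl⟩ : ∃ w : List ℕ, w.Perm (List.range n) ∧ v = w.map φ := by
      have h1 := h.1.map (Function.invFun φ)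
      rw [List.map_map, Function.invFun_comp hφ, List.map_id] at h1
      refine ⟨_, h1, ?_⟩
      rw [List.map_map]
      refine ((List.map_congr_left fun a ha => ?_).trans (List.map_id v)).symm
      obtain ⟨b, -, rfl⟩ := List.mem_map.1 (h.1.subset ha)
      exact congrArg φ (Function.leftInverse_invFun hφ b)
    have hn : w.Nodup := hw.nodup_iff.2 List.nodup_range
    exact ⟨w, List.mem_permutations'.2 hw, (EvenPerm.map_iff hn hφ).1 h, rfl⟩
  · rintro ⟨w, -, hw, rfl⟩
    exact (EvenPerm.map_iff (hw.nodup_iff.2 List.nodup_range) hφ).2 hw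

/-- The ways to extend `[3, 0, 2, 1]` to all even words of four letters but the identity. -/
def fourEdges : List (ℕ × List ℕ) :=
  [(1, [3, 0, 2, 1]), (0, [3, 1, 0, 2]), (0, [3, 0, 2, 1]), (1, [2, 3, 0, 1]),
    (1, [1, 0, 3, 2])]

/-- For at least four letters, the even words other than `u` are connected.  Here the prefix is such
that the exceptional set does not interfere. -/
theorem connected_evenWords_diff {Sp : Set (List ℕ × List ℕ)} {pre₀ : List ℕ}
    (hSp : ∀ p ∈ Sp, p.1 = pre₀) {m : ℕ} (hm : 4 ≤ m) {pre u : List ℕ} (hu : u.Nodup)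
    (hl : u.length = m) (hpre : ¬ pre <+: pre₀) : Connected Sp (evenWords pre u \ {pre ++ u}) := by
  induction m, hm using Nat.le_induction generalizing pre u with
  | base =>
    obtain ⟨φ, hφ, hφu⟩ := exists_injective_map_range hu
    rw [hl] at hφu
    have h1 : Connected Sp {l | ∃ w ∈ [[3, 0, 2, 1]], l = pre ++ w.map φ} := by
      convert connected_singleton Sp (pre ++ [3, 0, 2, 1].map φ) using 1
      ext l
      simp
    have h2 := connected_grow hφ (bad := []) (fun x z h => absurd ⟨_, hSp _ h⟩ hpre) fourEdges h1
      (by decide +kernel)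
    convert h2 using 1
    have h3 : ∀ w ∈ (List.range 4).permutations',
        (EvenPerm w (List.range 4) ∧ w ≠ List.range 4 ↔
          w ∈ fourEdges.foldl grow [[3, 0, 2, 1]]) := by
      decide +kernel
    have h4 : ∀ w ∈ fourEdges.foldl grow [[3, 0, 2, 1]], w ∈ (List.range 4).permutations' := by
      decide +kernel
    ext l
    constructor
    · rintro ⟨⟨v, hv, rfl⟩, hne⟩
      rw [hφu, evenPerm_map_range_iff hφ] at hv
      obtain ⟨w, hw, hwe, rfl⟩ := hv
      refine ⟨w, (h3 w hw).1 ⟨hwe, fun h => hne ?_⟩, rfl⟩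
      rw [h, ← hφu]
      rfl
    · rintro ⟨w, hw, rfl⟩
      have h5 := (h3 w (h4 w hw)).2 hw
      refine ⟨⟨w.map φ, ?_, rfl⟩, fun h => h5.2 ?_⟩
      · rw [hφu, evenPerm_map_range_iff hφ]
        exact ⟨w, h4 w hw, h5.1, rfl⟩
      · have h6 : w.map φ = u := List.append_cancel_left h
        rw [hφu] at h6
        exact hφ.list_map h6
  | succ m hm ih =>
    obtain _ | ⟨o, u⟩ := u
    · simp at hl
    have hsub : ∀ p, ¬ pre ++ [p] <+: pre₀ := fun p h =>
      hpre ((List.prefix_append pre [p]).trans h)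
    have hlu : u.length = m := by simpa using hl
    have key : ∀ p v, EvenPerm (p :: v) (o :: u) →
        Connected Sp (evenWords (pre ++ [p]) v \ {pre ++ p :: v}) := by
      intro p v h
      have hv := (List.nodup_cons.1 (h.nodup_iff.2 hu)).2
      have hlv : v.length = m := by simpa [hlu] using h.length_eq
      simpa using ih hv hlv (hsub p)
    refine connected_of_hub hu (by omega) (fun y h => hpre ?_) subset_rfl
      (key o u (EvenPerm.refl _)) fun p _ => key p
    rw [← hSp _ h]

/-- Six words of five letters, each of which arises from the one before (cyclically) by moving the
third or the fifth letter to the front. -/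
def linkWord : Fin 6 → List ℕ :=
  ![[0, 1, 2, 3, 4], [2, 0, 1, 3, 4], [4, 2, 0, 1, 3], [3, 4, 2, 0, 1], [2, 3, 4, 0, 1],
    [1, 2, 3, 4, 0]]

/-- The pointed words at which the successors are permuted in order to join the six necklaces
`pre ++ linkWord i`. -/
def link (pre : List ℕ) (φ : ℕ → ℕ) : Set (List ℕ × List ℕ) :=
  {p | ∃ i, p = (pre, (linkWord i).map φ)}

/-- The six necklaces `pre ++ linkWord i` are connected.  As their number is even, this link changes
the parity of the number of cycles, which no rotation of three letters does. -/
theorem connected_link (pre : List ℕ) {φ : ℕ → ℕ} (hφ : Function.Injective φ) :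
    Connected (link pre φ) {l | ∃ i, l = pre ++ (linkWord i).map φ} := by
  classical
  let s : Fin 6 → List ℕ × List ℕ := fun i => (pre, (linkWord i).map φ)
  have hs : Function.Injective s := by
    have hw : ∀ i j, linkWord i = linkWord j → i = j := by decide
    exact fun i j h => hw i j (hφ.list_map (Prod.mk.inj h).2)
  let g : List ℕ × List ℕ → List ℕ × List ℕ := fun p =>
    if h : ∃ i, p = s i then rot (s (h.choose + 1)) else rot p
  have g_link : ∀ i, g (s i) = rot (s (i + 1)) := by
    intro i
    have h : ∃ j, s i = s j := ⟨i, rfl⟩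
    simp only [g, dif_pos h]
    rw [← hs h.choose_spec]
  have g_else : ∀ p, p ∉ link pre φ → g p = rot p := fun p h => dif_neg h
  refine ⟨g, fun p _ => ?_, fun x a b c y _ h h' => absurd (g_else _ h) h', ?_⟩
  · by_cases h : p ∈ link pre φ
    · obtain ⟨i, rfl⟩ := h
      change Move (s i) (g (s i))
      rw [g_link]
      fin_cases i
      exacts [.three _ _ _ _ _, .five _ _ _ _ _ _ _, .five _ _ _ _ _ _ _, .three _ _ _ _ _,
        .five _ _ _ _ _ _ _, .five _ _ _ _ _ _ _]
    · rw [g_else p h]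
      exact .one p
  · have := Cyc.merge (m := 5) (S := fun i => {p | necklace p = pre ++ (linkWord i).map φ})
      (g := fun _ => rot) (x := s) (g' := g) (fun i => cyc_rot _) (fun i => rfl)
      (fun i p hp hne => g_else p ?_) g_link
    · convert this using 1
      ext p
      simp
    · rintro ⟨j, rfl⟩
      have h1 : linkWord j = linkWord i := hφ.list_map (List.append_cancel_left hp)
      exact hne (by simp only [s, h1])

/-- The ways to extend the six words `linkWord i` to all even words of five letters. -/
def fiveEdges : List (ℕ × List ℕ) :=
  [(1, [2, 0, 1, 3, 4]), (0, [2, 1, 3, 0, 4]), (1, [0, 1, 2, 3, 4]), (2, [0, 3, 1, 2, 4]),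
    (0, [0, 3, 4, 1, 2]), (2, [4, 0, 3, 1, 2]), (0, [4, 0, 2, 3, 1]), (1, [4, 0, 2, 3, 1]),
    (2, [4, 3, 0, 2, 1]), (2, [2, 1, 3, 0, 4]), (0, [2, 1, 4, 3, 0]), (0, [2, 1, 0, 4, 3]),
    (1, [1, 0, 2, 4, 3]), (2, [1, 3, 2, 0, 4]), (1, [1, 3, 0, 4, 2]), (1, [3, 4, 0, 1, 2]),
    (2, [0, 1, 2, 3, 4]), (1, [2, 1, 0, 4, 3]), (0, [4, 3, 0, 2, 1]), (1, [1, 3, 2, 0, 4]),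
    (1, [2, 1, 4, 3, 0]), (0, [1, 3, 4, 2, 0]), (1, [3, 4, 1, 2, 0]), (2, [0, 4, 3, 2, 1]),
    (1, [3, 2, 1, 0, 4]), (2, [4, 1, 3, 2, 0]), (0, [0, 3, 2, 4, 1])]

theorem connected_evenWords_five (pre : List ℕ) {φ : ℕ → ℕ} (hφ : Function.Injective φ) :
    Connected (link pre φ) (evenWords pre ((List.range 5).map φ)) := by
  have h1 : Connected (link pre φ) {l | ∃ w ∈ List.ofFn linkWord, l = pre ++ w.map φ} := by
    convert connected_link pre hφ using 1
    ext l
    constructor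
    · rintro ⟨w, hw, rfl⟩
      obtain ⟨i, rfl⟩ := List.mem_ofFn.1 hw
      exact ⟨i, rfl⟩
    · rintro ⟨i, rfl⟩
      exact ⟨_, List.mem_ofFn.2 ⟨i, rfl⟩, rfl⟩
  have h2 := connected_grow hφ (bad := List.ofFn linkWord) (fun x z h => ?_) fiveEdges h1
    (by decide +kernel)
  · convert h2 using 1
    have h3 : ∀ w ∈ (List.range 5).permutations',
        (EvenPerm w (List.range 5) ↔ w ∈ fiveEdges.foldl grow (List.ofFn linkWord)) := by
      decide +kernel
    have h4 : ∀ w ∈ fiveEdges.foldl grow (List.ofFn linkWord),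
        w ∈ (List.range 5).permutations' := by
      decide +kernel
    ext l
    constructor
    · rintro ⟨v, hv, rfl⟩
      rw [evenPerm_map_range_iff hφ] at hv
      obtain ⟨w, hw, hwe, rfl⟩ := hv
      exact ⟨w, (h3 w hw).1 hwe, rfl⟩
    · rintro ⟨w, hw, rfl⟩
      exact ⟨_, (evenPerm_map_range_iff hφ).2 ⟨w, h4 w hw, (h3 w (h4 w hw)).2 hw, rfl⟩, rfl⟩
  · obtain ⟨i, hi⟩ := h
    rw [Prod.mk.injEq] at hi
    exact ⟨by simpa using hi.1, List.mem_ofFn.2 ⟨i, (hφ.list_map hi.2).symm⟩⟩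

/-- With the link, all even words of at least five letters are connected. -/
theorem connected_evenWords {pre suf : List ℕ} {φ : ℕ → ℕ} (hφ : Function.Injective φ)
    (hn : (suf ++ (List.range 5).map φ).Nodup) :
    Connected (link (pre ++ suf) φ) (evenWords pre (suf ++ (List.range 5).map φ)) := by
  induction suf generalizing pre with
  | nil => simpa using connected_evenWords_five pre hφ
  | cons o suf ih =>
    have hu : (o :: (suf ++ (List.range 5).map φ)).Nodup := hn
    have hhub := ih (pre := pre ++ [o]) (List.nodup_cons.1 hu).2
    rw [List.append_assoc, List.singleton_append] at hhub
    have := connected_of_hub (Sp := link (pre ++ o :: suf) φ) (pre := pre) hu (by simp)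
      (fun y h => ?_) (X := ∅) (Set.empty_subset _) (by simpa using hhub) fun p hp v hv => ?_
    · simpa using this
    · obtain ⟨i, hi⟩ := h
      simp at hi
    · have hvn := (List.nodup_cons.1 (hv.nodup_iff.2 hu)).2
      have hlv : v.length = suf.length + 5 := by simpa using hv.length_eq
      have h := connected_evenWords_diff (Sp := link (pre ++ o :: suf) φ) (pre₀ := pre ++ o :: suf)
        (by rintro _ ⟨i, rfl⟩; rfl) (m := suf.length + 5) (by omega) (pre := pre ++ [p]) hvn hlv
        (fun h => ?_)
      · simpa using h
      · rw [List.prefix_append_right_inj, List.cons_prefix_cons] at h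
        exact (List.nodup_cons.1 hu).1 (h.1 ▸ hp)

/-! ### Tours through even words -/

/-- For every word `u` of `n` letters there is a cyclic sequence of `N` even rearrangements of `u`,
each of which arises from the one before by a step, that ends in `u` and in which the step from `u`
is the rotation. -/
def HasTour (n N : ℕ) : Prop :=
  ∀ u : List ℕ, u.Nodup → u.length = n → ∃ D : List (List ℕ), D.length = N ∧ D.Nodup ∧
    D.IsChain Step ∧ D.head? = some (u.rotate 1) ∧ D.getLast? = some u ∧ ∀ d ∈ D, EvenPerm d u

/-- The words that arise from `w` in turn by moving the letters at the given positions to the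
end. -/
def follow (w : List ℕ) : List ℕ → List (List ℕ)
  | [] => []
  | i :: is => (w.eraseIdx i ++ [w.getD i 0]) :: follow (w.eraseIdx i ++ [w.getD i 0]) is

theorem step_eraseIdx {w : List ℕ} {i : ℕ} (h : i + 1 < w.length) :
    Step w (w.eraseIdx i ++ [w.getD i 0]) := by
  refine ⟨w.take i, w[i], w.drop (i + 1), ?_, ?_, ?_⟩
  · rw [ne_eq, List.drop_eq_nil_iff]; omega
  · rw [List.getElem_cons_drop, List.take_append_drop]
  · rw [List.eraseIdx_eq_take_drop_succ, List.getD_eq_getElem w 0 (by omega)]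

theorem isChain_follow {n : ℕ} {is : List ℕ} (h : ∀ i ∈ is, i + 1 < n) {w : List ℕ}
    (hw : w.length = n) : (w :: follow w is).IsChain Step := by
  induction is generalizing w with
  | nil => exact List.isChain_singleton w
  | cons i is ih =>
    have hi : i + 1 < w.length := hw ▸ h i List.mem_cons_self
    refine List.isChain_cons_cons.2 ⟨step_eraseIdx hi, ?_⟩
    refine ih (fun j hj => h j (List.mem_cons_of_mem i hj)) ?_
    rw [List.length_append, List.length_eraseIdx_of_lt (by omega), List.length_singleton]
    omega

/-- A tour can be given by the positions from which letters are moved. -/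
theorem hasTour_of_follow {n : ℕ} (is : List ℕ) (h₁ : ∀ i ∈ is, i + 1 < n)
    (h₂ : (follow (List.range n) is).Nodup)
    (h₃ : (follow (List.range n) is).head? = some ((List.range n).rotate 1))
    (h₄ : (follow (List.range n) is).getLast? = some (List.range n))
    (h₅ : ∀ d ∈ follow (List.range n) is, EvenPerm d (List.range n)) :
    HasTour n (follow (List.range n) is).length := by
  intro u hu hl
  obtain ⟨φ, hφ, hφu⟩ := exists_injective_map_range hu
  rw [hl] at hφu
  refine ⟨(follow (List.range n) is).map (List.map φ), by simp, h₂.map hφ.list_map, ?_, ?_, ?_, ?_⟩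
  · rw [List.isChain_map]
    exact (isChain_follow h₁ List.length_range).tail.imp fun _ _ h => h.map φ
  · rw [List.head?_map, h₃, hφu, ← List.map_rotate]; rfl
  · rw [List.getLast?_map, h₄, hφu]; rfl
  · intro d hd
    obtain ⟨w, hw, rfl⟩ := List.mem_map.1 hd
    rw [hφu]
    exact (EvenPerm.map_iff ((h₅ w hw).nodup_iff.2 List.nodup_range) hφ).2 (h₅ w hw)

theorem hasTour_three : HasTour 3 3 := by
  have := hasTour_of_follow (n := 3) [0, 0, 0] (by decide) (by decide) (by decide) (by decide)
    (by decide)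
  exact this

theorem hasTour_five_57 : HasTour 5 57 := by
  have := hasTour_of_follow (n := 5) [0, 2, 2, 0, 2, 2, 0, 0, 2, 2, 0, 0, 2, 0, 2, 2, 0, 2, 2, 0, 0, 0, 2, 2, 0, 2, 0, 0, 2, 2,
    0, 2, 2, 0, 2, 0, 2, 2, 0, 0, 0, 2, 2, 0, 2, 0, 2, 2, 0, 2, 2, 0, 0, 0, 2, 0, 2] (by decide +kernel)
    (by decide +kernel) (by decide +kernel) (by decide +kernel) (by decide +kernel)
  exact this

theorem hasTour_five_55 : HasTour 5 55 := by
  have := hasTour_of_follow (n := 5) [0, 0, 2, 2, 0, 0, 0, 2, 0, 0, 0, 0, 2, 0, 0, 0, 0, 2, 2, 0, 0, 0, 2, 0, 0, 0, 2, 0, 0, 0,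
    0, 2, 0, 0, 0, 0, 2, 2, 0, 0, 0, 0, 2, 2, 0, 0, 0, 2, 0, 0, 0, 0, 2, 0, 0] (by decide +kernel)
    (by decide +kernel) (by decide +kernel) (by decide +kernel) (by decide +kernel)
  exact this

theorem evenPerm_append_comm {y : List ℕ} : ∀ {z : List ℕ}, (y ++ z).Nodup →
    Odd (y ++ z).length → EvenPerm (y ++ z) (z ++ y) := by
  induction y with
  | nil => intro z _ _; simpa using EvenPerm.refl z
  | cons b y ih =>
    intro z hn hl
    have h1 : EvenPerm ((y ++ z) ++ [b]) (b :: (y ++ z)) := by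
      refine evenPerm_append_singleton (List.nodup_cons.1 hn).1 ?_
      rw [List.cons_append, List.length_cons] at hl
      exact Nat.odd_add_one.1 hl |> Nat.not_odd_iff_even.1
    have h2 := ih (z := z ++ [b]) (by rw [← List.append_assoc]; exact h1.nodup_iff.2 hn)
      (by rw [← List.append_assoc, h1.length_eq]; exact hl)
    rw [← List.append_assoc] at h2
    simpa using h1.symm.trans h2

/-- Half of the rearrangements of a word are even. -/
theorem card_evenPerm {u : List ℕ} (hu : u.Nodup) (hl : 2 ≤ u.length) :
    {w ∈ u.permutations.toFinset | EvenPerm w u}.card = u.length.factorial / 2 := by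
  let f : List ℕ → List ℕ := fun w => match w with
    | a :: b :: r => b :: a :: r
    | w => w
  have hff : ∀ w, f (f w) = w := by
    rintro (_ | ⟨a, _ | ⟨b, r⟩⟩) <;> rfl
  have hf : ∀ w, w.Perm u → (f w).Perm u ∧ (inversions (f w) + inversions w) % 2 = 1 := by
    rintro (_ | ⟨a, _ | ⟨b, r⟩⟩) h
    · have := h.length_eq; simp at this; omega
    · have := h.length_eq; simp at this; omega
    · have hn := h.nodup_iff.2 hu
      have hab : b ≠ a := by
        rintro rfl
        simp at hn
      exact ⟨(List.Perm.swap a b r).trans h, inversions_swap [] r hab⟩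
  have h1 : {w ∈ u.permutations.toFinset | EvenPerm w u}.card =
      {w ∈ u.permutations.toFinset | ¬ EvenPerm w u}.card := by
    refine Finset.card_bij' (fun w _ => f w) (fun w _ => f w) ?_ ?_ (fun w _ => hff w)
      (fun w _ => hff w)
    · intro w hw
      simp only [Finset.mem_filter, List.mem_toFinset, List.mem_permutations] at hw ⊢
      obtain ⟨h2, h3⟩ := hf w hw.1
      refine ⟨h2, fun h4 => ?_⟩
      have h5 := h4.2
      have h6 := hw.2.2
      omega
    · intro w hw
      simp only [Finset.mem_filter, List.mem_toFinset, List.mem_permutations] at hw ⊢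
      obtain ⟨h2, h3⟩ := hf w hw.1
      refine ⟨h2, h2, ?_⟩
      have h4 : ¬ inversions w % 2 = inversions u % 2 := fun h => hw.2 ⟨hw.1, h⟩
      omega
  have h2 := Finset.card_filter_add_card_filter_not (s := u.permutations.toFinset)
    (fun w => EvenPerm w u)
  rw [List.toFinset_card_of_nodup (List.nodup_permutations u hu), List.length_permutations] at h2
  omega

theorem Move.eq_rot {x : List ℕ} {q : List ℕ × List ℕ} (h : Move (x, []) q) : q = rot (x, []) := by
  cases h
  rfl

/-- A move of pointed words is a step of the words that they stand for. -/
theorem Move.step {p q : List ℕ × List ℕ} (h : Move p q) {s : ℕ} (hp : p ≠ ([], [])) :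
    Step (p.2 ++ s :: p.1) (q.2 ++ s :: q.1) := by
  cases h with
  | one =>
    obtain ⟨x, _ | ⟨b, y⟩⟩ := p
    · refine step_rotate s fun h => hp ?_
      obtain rfl : x = [] := h
      rfl
    · exact ⟨[], b, y ++ s :: x, by simp, rfl, by simp [rot]⟩
  | three x a b c y => exact ⟨[a, b], c, y ++ s :: x, by simp, rfl, by simp⟩
  | five x a b c d e y => exact ⟨[a, b, c, d], e, y ++ s :: x, by simp, rfl, by simp⟩

/-- A single cycle through all pointed words with an even necklace is a tour through all even
words. -/
theorem hasTour_of_connected {n : ℕ} (hn : Odd n) (h3 : 3 ≤ n)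
    (h : ∀ x : List ℕ, x.Nodup → x.length + 1 = n → ∃ Sp, Connected Sp (evenWords [] x)) :
    HasTour n (n.factorial / 2) := by
  intro u hu hl
  obtain _ | ⟨s, x⟩ := u
  · simp at hl; omega
  have hlx : x.length + 1 = n := hl
  obtain ⟨hs, hx⟩ := List.nodup_cons.1 hu
  obtain ⟨Sp, g, hg⟩ := h x hx hlx
  let S : Set (List ℕ × List ℕ) := {p | necklace p ∈ evenWords [] x}
  have hS : ∀ p, p ∈ S ↔ EvenPerm (p.1 ++ p.2) x := by
    intro p
    constructor
    · rintro ⟨v, hv, hp⟩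
      have hp' : p.1 ++ p.2 = v := hp
      rwa [hp']
    · exact fun h => ⟨_, h, rfl⟩
  let word : List ℕ × List ℕ → List ℕ := fun p => p.2 ++ s :: p.1
  have word_even : ∀ p, EvenPerm (p.1 ++ p.2) x → EvenPerm (word p) (s :: x) := by
    intro p hp
    have h1 : EvenPerm (s :: (p.1 ++ p.2)) (s :: x) :=
      (EvenPerm.cons_iff (hp.nodup_iff.2 hx) s).2 hp
    refine EvenPerm.trans ?_ h1
    have h2 : (word p).Perm (s :: (p.1 ++ p.2)) := by
      have : (word p).Perm ((s :: p.1) ++ p.2) := List.perm_append_comm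
      exact this
    have h3 := h2.trans h1.1
    exact evenPerm_append_comm (h3.nodup_iff.2 hu)
      (by rw [h3.length_eq, List.length_cons, hlx]; exact hn)
  have even_word : ∀ p, EvenPerm (word p) (s :: x) → EvenPerm (p.1 ++ p.2) x := by
    intro p hp
    have h1 := evenPerm_append_comm (hp.nodup_iff.2 hu)
      (by rw [hp.length_eq, List.length_cons, hlx]; exact hn)
    have h2 := h1.symm.trans hp
    have h3 := (List.nodup_cons.1 (h2.nodup_iff.2 hu)).2
    exact (EvenPerm.cons_iff h3 s).1 h2
  have word_inj : ∀ p ∈ S, ∀ q, word p = word q → p = q := by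
    rintro ⟨x₁, y₁⟩ hp ⟨x₂, y₂⟩ h
    have h1 : s ∉ x₁ ++ y₁ := fun h => hs ((((hS _).1 hp).1).subset h)
    simp only [List.mem_append, not_or] at h1
    have h4 : y₁ ++ s :: x₁ = y₂ ++ s :: x₂ := h
    rw [List.append_cons_inj_of_notMem h1.2 h1.1] at h4
    rw [h4.1, h4.2.2]
  let p₀ : List ℕ × List ℕ := ([], x)
  let p₁ : List ℕ × List ℕ := (x, [])
  have hp₀ : p₀ ∈ S := (hS _).2 (EvenPerm.refl x)
  have hp₁ : p₁ ∈ S := (hS _).2 (by simpa [p₁] using EvenPerm.refl x)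
  have hgp₁ : g p₁ = p₀ := (hg.move p₁ hp₁).eq_rot
  let N := Function.minimalPeriod g p₀
  have hper : p₀ ∈ Function.periodicPts g := by
    obtain ⟨i, hi⟩ := hg.cyc.2 p₀ hp₀ p₁ hp₁
    refine Function.mk_mem_periodicPts (n := i + 1) (by omega) ?_
    change g^[i + 1] p₀ = p₀
    rw [Function.iterate_succ_apply', hi, hgp₁]
  have hN : 0 < N := Function.minimalPeriod_pos_of_mem_periodicPts hper
  have hmem : ∀ i, g^[i] p₀ ∈ S := hg.cyc.iterate_mem hp₀
  have hreach : ∀ q ∈ S, ∃ i < N, g^[i] p₀ = q := by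
    intro q hq
    obtain ⟨i, hi⟩ := hg.cyc.2 p₀ hp₀ q hq
    exact ⟨i % N, Nat.mod_lt i hN, by rw [Function.iterate_mod_minimalPeriod_eq, hi]⟩
  have hlast : g^[N - 1] p₀ = p₁ := by
    obtain ⟨i, hi, hip⟩ := hreach p₁ hp₁
    have h1 : Function.IsPeriodicPt g (i + 1) p₀ := by
      change g^[i + 1] p₀ = p₀
      rw [Function.iterate_succ_apply', hip, hgp₁]
    have h2 := Nat.le_of_dvd (by omega) h1.minimalPeriod_dvd
    rw [show N - 1 = i by omega, hip]
  let D : List (List ℕ) := (List.range N).map fun i => word (g^[i] p₀)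
  have hDn : D.Nodup := by
    refine List.Nodup.map_on (fun i hi j hj hij => ?_) List.nodup_range
    exact Function.iterate_injOn_Iio_minimalPeriod (List.mem_range.1 hi) (List.mem_range.1 hj)
      (word_inj _ (hmem i) _ hij)
  have hDe : ∀ d ∈ D, EvenPerm d (s :: x) := by
    intro d hd
    obtain ⟨i, -, rfl⟩ := List.mem_map.1 hd
    exact word_even _ ((hS _).1 (hmem i))
  refine ⟨D, ?_, hDn, ?_, ?_, ?_, hDe⟩
  · rw [← hl, ← card_evenPerm hu (by omega), ← List.toFinset_card_of_nodup hDn]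
    congr 1
    ext d
    simp only [Finset.mem_filter, List.mem_toFinset, List.mem_permutations]
    refine ⟨fun hd => ⟨(hDe d hd).1, hDe d hd⟩, fun hd => ?_⟩
    obtain ⟨y, x', rfl⟩ := List.append_of_mem (hd.1.symm.subset List.mem_cons_self)
    obtain ⟨i, hi, hip⟩ := hreach (x', y) ((hS _).2 (even_word (x', y) hd.2))
    exact List.mem_map.2 ⟨i, List.mem_range.2 hi, by rw [hip]⟩
  · rw [List.isChain_map, List.isChain_range]
    intro i hi
    change Step (word (g^[i] p₀)) (word (g^[i + 1] p₀))
    rw [Function.iterate_succ_apply']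
    refine (hg.move _ (hmem i)).step fun h0 => ?_
    have h1 := ((hS _).1 (hmem i)).length_eq
    rw [h0] at h1
    simp at h1
    omega
  · obtain ⟨k, hk⟩ : ∃ k, N = k + 1 := ⟨N - 1, by omega⟩
    simp [D, hk, List.range_succ_eq_map, word, p₀]
  · obtain ⟨k, hk⟩ : ∃ k, N = k + 1 := ⟨N - 1, by omega⟩
    have h1 : g^[k] p₀ = p₁ := by rw [← hlast, hk, Nat.add_sub_cancel]
    simp [D, hk, List.range_succ, h1, word, p₁]

/-- The push-to-the-top transitions of odd index lead through all even permutations in a cycle if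
`n ≥ 7` is odd.  The letters that precede the last five are the prefix of the link. -/
theorem hasTour_factorial {n : ℕ} (hn : Odd n) (h7 : 7 ≤ n) : HasTour n (n.factorial / 2) := by
  refine hasTour_of_connected hn (by omega) fun x hx hl => ?_
  have hd : (x.drop (n - 6)).length = 5 := by rw [List.length_drop]; omega
  obtain ⟨φ, hφ, h⟩ := exists_injective_map_range (hx.sublist (List.drop_sublist (n - 6) x))
  rw [hd] at h
  have hx' : x = x.take (n - 6) ++ (List.range 5).map φ := by rw [← h, List.take_append_drop]
  rw [hx']
  exact ⟨_, connected_evenWords (pre := []) hφ (hx' ▸ hx)⟩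

/-! ### Auxiliary codes as lists of words -/

/-- The list of words `C`, cyclically traversed, is an auxiliary code: `K` is the distinguished
letter, the first word is `u` and the first step is the rotation. -/
structure IsWordCode (K : ℕ) (u : List ℕ) (C : List (List ℕ)) : Prop where
  start : ∃ R, C = u :: u.rotate 1 :: R
  perm : ∀ w ∈ C, w.Perm u
  nodup : C.Nodup
  chain : (C ++ [u]).IsChain Step
  aux : ∀ q ∈ u, q ≠ K → ∀ w ∈ C, w.map (swap q K) ∉ C

theorem step_rotate_one {u : List ℕ} (hl : 2 ≤ u.length) : Step u (u.rotate 1) := by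
  obtain _ | ⟨a, _ | ⟨b, l⟩⟩ := u
  · simp at hl
  · simp at hl
  · exact step_rotate a (List.cons_ne_nil b l)

/-- A tour through even words is an auxiliary code, as a transposition of two letters makes an even
word odd. -/
theorem HasTour.isWordCode {n N : ℕ} (h : HasTour n N) {u : List ℕ} (hu : u.Nodup)
    (hl : u.length = n) (hn : 2 ≤ n) {K : ℕ} (hK : K ∈ u) :
    ∃ C, C.length = N ∧ IsWordCode K u C := by
  obtain ⟨D, hDN, hDn, hDc, hDh, hDl, hDe⟩ := h u hu hl
  obtain ⟨D', rfl⟩ := List.getLast?_eq_some_iff.1 hDl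
  have hperm : (u :: D').Perm (D' ++ [u]) := (List.perm_append_singleton u D').symm
  have he : ∀ w ∈ u :: D', EvenPerm w u := fun w hw => hDe w (hperm.subset hw)
  obtain _ | ⟨v, R⟩ := D'
  · -- A one-word tour is impossible: a word with distinct letters differs from its rotation.
    obtain _ | ⟨a, _ | ⟨b, l⟩⟩ := u
    · simp at hl; omega
    · simp at hl; omega
    · simp at hDh
      simp [hDh.1] at hu
  · obtain rfl : v = u.rotate 1 := by simpa using hDh
    refine ⟨_, by rw [hperm.length_eq, hDN], ⟨R, rfl⟩, fun w hw => (he w hw).1,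
      hperm.nodup_iff.2 hDn, ?_, ?_⟩
    · exact List.isChain_cons_cons.2 ⟨step_rotate_one (hl ▸ hn), hDc⟩
    · intro q hq hqK w hw hw'
      have h1 := he w hw
      have h2 := he _ hw'
      have h3 := inversions_map_swap (h1.nodup_iff.2 hu) (h1.1.symm.subset hq)
        (h1.1.symm.subset hK) hqK
      have h4 := h1.2
      have h5 := h2.2
      omega

/-- A path that visits, for a fixed letter `c`, the words `c b …` for the letters `b` of `l`, then
`c z …`, each arising from the one before by moving `b` to the end; between two of them it tours
through all words of the parity opposite to theirs that begin with `b`. -/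
theorem exists_hub_path {n c z : ℕ} (hn : Odd n) (Ns : List ℕ) (hNs : ∀ N ∈ Ns, HasTour n N) :
    ∀ (l r : List ℕ), l.length = Ns.length → (c :: (l ++ z :: r)).Nodup →
    (l ++ z :: r).length = n → 2 ≤ n →
    ∃ P : List (List ℕ), P.length = Ns.sum + l.length + 1 ∧ P.Nodup ∧ P.IsChain Step ∧
      P.head? = some (c :: (l ++ z :: r)) ∧ P.getLast? = some (c :: z :: (r ++ l)) ∧
      ∀ w ∈ P, (EvenPerm w (c :: (l ++ z :: r)) ∧ ∃ b ∈ l ++ [z], ∃ v, w = c :: b :: v) ∨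
        (w.Perm (c :: (l ++ z :: r)) ∧
          (inversions w + inversions (c :: (l ++ z :: r))) % 2 = 1 ∧ ∃ b ∈ l, ∃ v, w = b :: v) := by
  induction Ns with
  | nil =>
    intro l r hlen hnd hl hn2
    obtain rfl := List.length_eq_zero_iff.1 hlen
    refine ⟨[c :: z :: r], by simp, by simp, by simp, rfl, by simp, fun w hw => .inl ?_⟩
    obtain rfl := List.mem_singleton.1 hw
    exact ⟨EvenPerm.refl _, z, by simp, r, rfl⟩
  | cons N Ns ih =>
    intro l r hlen hnd hl hn2
    obtain _ | ⟨b, l⟩ := l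
    · simp at hlen
    let m := l ++ z :: r
    have hm : b :: l ++ z :: r = b :: m := rfl
    have hrec : l ++ z :: (r ++ [b]) = m ++ [b] := by simp [m]
    rw [hm] at hnd hl ⊢
    simp only [List.nodup_cons, List.mem_cons, not_or] at hnd
    obtain ⟨⟨hcb, hcm⟩, hbm, hmn⟩ := hnd
    have hml : m.length + 1 = n := hl
    have hme : Even m.length := by
      rw [← hml] at hn
      exact Nat.not_odd_iff_even.1 (Nat.odd_add_one.1 hn)
    have hcm' : (c :: m).Nodup := List.nodup_cons.2 ⟨hcm, hmn⟩
    have hnd₀ : (c :: b :: m).Nodup := by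
      simp only [List.nodup_cons, List.mem_cons, not_or]
      exact ⟨⟨hcb, hcm⟩, hbm, hmn⟩
    have heven : EvenPerm (c :: (m ++ [b])) (c :: b :: m) :=
      (EvenPerm.cons_iff ((List.perm_append_singleton b m).nodup_iff.2
        (List.nodup_cons.1 hnd₀).2) c).2 (evenPerm_append_singleton hbm hme)
    obtain ⟨P, hPN, hPn, hPc, hPh, hPl, hP⟩ := ih (fun N hN => hNs N (List.mem_cons_of_mem _ hN)) l
      (r ++ [b]) (by simpa using hlen) (by rw [hrec]; exact heven.nodup_iff.2 hnd₀)
      (by rw [hrec]; simpa using hl) hn2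
    rw [hrec] at hPh hP
    obtain ⟨D, hDN, hDn, hDc, hDh, hDl, hDe⟩ := hNs N List.mem_cons_self (c :: m) hcm' hml
    have hmne : m ≠ [] := by simp [m]
    have hswap : (inversions (b :: c :: m) + inversions (c :: b :: m)) % 2 = 1 :=
      inversions_swap [] m (Ne.symm hcb)
    have hD : ∀ w ∈ D.map (List.cons b), (w.Perm (c :: b :: m) ∧
        (inversions w + inversions (c :: b :: m)) % 2 = 1) ∧ ∃ v, w = b :: v := by
      intro w hw
      obtain ⟨d, hd, rfl⟩ := List.mem_map.1 hw
      have h1 := (EvenPerm.cons_iff ((hDe d hd).nodup_iff.2 hcm') b).2 (hDe d hd)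
      refine ⟨⟨h1.1.trans (List.Perm.swap c b m), ?_⟩, d, rfl⟩
      have := h1.2
      omega
    have hPhead : ∀ w ∈ P, w ≠ c :: b :: m ∧ ∀ v, w ≠ b :: v := by
      intro w hw
      rcases hP w hw with ⟨-, b', hb', v, rfl⟩ | ⟨-, -, b', hb', v, rfl⟩
      · refine ⟨fun h => ?_, fun v h => hcb (List.cons.inj h).1⟩
        simp only [List.cons.injEq, true_and] at h
        rw [h.1] at hb'
        exact hbm (by simpa [m, or_assoc] using Or.inl hb')
      · refine ⟨fun h => ?_, fun v h => ?_⟩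
        · rw [(List.cons.inj h).1] at hb'
          exact hcm (by simp [m, hb'])
        · rw [(List.cons.inj h).1] at hb'
          exact hbm (by simp [m, hb'])
    refine ⟨(c :: b :: m) :: (D.map (List.cons b) ++ P), ?_, ?_, ?_, rfl, ?_, ?_⟩
    · simp [hDN, hPN]
      omega
    · refine List.nodup_cons.2 ⟨fun h => ?_, ?_⟩
      · rcases List.mem_append.1 h with h | h
        · obtain ⟨-, v, hv⟩ := hD _ h
          exact hcb (List.cons.inj hv).1
        · exact (hPhead _ h).1 rfl
      · refine List.Nodup.append (hDn.map List.cons_injective) hPn ?_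
        intro w hw hw'
        obtain ⟨-, v, hv⟩ := hD _ hw
        exact (hPhead _ hw').2 v hv
    · have hch : (D.map (List.cons b) ++ P).IsChain Step := by
        refine List.IsChain.append ?_ hPc ?_
        · rw [List.isChain_map]
          exact hDc.imp fun _ _ h => h.cons b
        · intro w hw w' hw'
          rw [List.getLast?_map, hDl] at hw
          rw [hPh] at hw'
          obtain rfl := Option.some_inj.1 hw
          obtain rfl := Option.some_inj.1 hw'
          exact step_rotate b (List.cons_ne_nil c m)
      refine List.IsChain.cons hch fun w hw => ?_
      rw [List.head?_append, List.head?_map, hDh] at hw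
      obtain rfl := Option.some_inj.1 hw
      have := step_rotate c (List.cons_ne_nil b m)
      simpa using this
    · rw [List.getLast?_cons, List.getLast?_append, hPl]
      simp
    · intro w hw
      rcases List.mem_cons.1 hw with rfl | hw
      · exact .inl ⟨EvenPerm.refl _, b, by simp, m, rfl⟩
      rcases List.mem_append.1 hw with hw | hw
      · obtain ⟨⟨h1, h2⟩, v, rfl⟩ := hD w hw
        exact .inr ⟨h1, h2, b, by simp, v, rfl⟩
      · rcases hP w hw with ⟨h1, b', hb', h2⟩ | ⟨h1, h2, b', hb', h3⟩
        · exact .inl ⟨h1.trans heven, b', List.mem_cons_of_mem b hb', h2⟩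
        · refine .inr ⟨h1.trans heven.1, ?_, b', List.mem_cons_of_mem b hb', h3⟩
          have := heven.2
          omega

/-- The auxiliary code for an even number of letters.  The word `K c l z` is followed by the path
along the words `c b …` with its tours through the words that begin with a letter of `l`; the code
closes up by the words `z K …` in which the remaining letters are rotated. -/
theorem exists_isWordCode_even {n K c z : ℕ} {l : List ℕ} (hn : Odd n) (h3 : 3 ≤ n)
    (hnd : (K :: c :: (l ++ [z])).Nodup) (hl : l.length + 2 = n) (Ns : List ℕ)
    (hNl : Ns.length = l.length) (hNs : ∀ N ∈ Ns, HasTour n N) :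
    ∃ C, C.length = Ns.sum + 2 * n - 1 ∧ IsWordCode K (K :: c :: (l ++ [z])) C := by
  have hrot : (K :: c :: (l ++ [z])).rotate 1 = c :: (l ++ z :: [K]) := by simp
  have hndr : (c :: (l ++ z :: [K])).Nodup := by rw [← hrot]; exact List.nodup_rotate.2 hnd
  have hpr : (c :: (l ++ z :: [K])).Perm (K :: c :: (l ++ [z])) := by
    rw [← hrot]; exact List.rotate_perm _ _
  obtain ⟨P, hPN, hPn, hPc, hPh, hPl, hP⟩ := exists_hub_path hn Ns hNs l [K] hNl.symm hndr
    (by simp; omega) (by omega)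
  -- The number of letters is even, so that the rotation is odd.
  have hW : (inversions (K :: c :: (l ++ [z])) + inversions (c :: (l ++ z :: [K]))) % 2 = 1 := by
    have h1 := inversions_append_singleton (List.nodup_cons.1 hnd).1
    have h2 : (c :: (l ++ [z])) ++ [K] = c :: (l ++ z :: [K]) := by simp
    rw [h2] at h1
    simp only [List.length_cons, List.length_append, List.length_nil] at h1
    obtain ⟨a, ha⟩ := hn
    omega
  obtain ⟨hKn, hcn, hln⟩ : K ∉ c :: (l ++ [z]) ∧ c ∉ l ++ [z] ∧ (l ++ [z]).Nodup := by
    simpa only [List.nodup_cons, and_assoc] using hnd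
  simp only [List.mem_cons, List.mem_append, List.not_mem_nil, or_false, not_or] at hKn hcn
  obtain ⟨hKc, hKl, hKz⟩ := hKn
  obtain ⟨hcl, hcz⟩ := hcn
  have hzl : z ∉ l := fun h => List.disjoint_of_nodup_append hln h (by simp)
  have htn : (l ++ [c]).Nodup :=
    (List.perm_append_singleton c l).nodup_iff.2
      (List.nodup_cons.2 ⟨hcl, (List.nodup_append.1 hln).1⟩)
  let Z : List (List ℕ) := (List.range (n - 1)).map fun i => z :: K :: (l ++ [c]).rotate i
  have hZ : ∀ w ∈ Z, w.Perm (K :: c :: (l ++ [z])) ∧ ∃ v, w = z :: K :: v := by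
    intro w hw
    obtain ⟨i, -, rfl⟩ := List.mem_map.1 hw
    refine ⟨?_, _, rfl⟩
    have h1 : (z :: K :: (l ++ [c]).rotate i).Perm (z :: K :: (c :: l)) :=
      (((List.rotate_perm _ i).trans (List.perm_append_singleton c l)).cons K).cons z
    have h2 : (z :: K :: (c :: l)).Perm (K :: c :: (l ++ [z])) :=
      (List.perm_append_singleton z (K :: c :: l)).symm
    exact h1.trans h2
  have hZn : Z.Nodup := by
    refine List.Nodup.map_on (fun i hi j hj hij => ?_) List.nodup_range
    simp only [List.cons.injEq, true_and] at hij
    have h1 := (List.Nodup.rotate_congr_iff htn).1 hij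
    simp only [List.length_append, List.length_singleton, List.append_eq_nil_iff,
      List.cons_ne_nil, and_false, or_false] at h1
    have hi' := List.mem_range.1 hi
    have hj' := List.mem_range.1 hj
    rwa [Nat.mod_eq_of_lt (by omega), Nat.mod_eq_of_lt (by omega)] at h1
  obtain ⟨k, hk⟩ : ∃ k, n - 1 = k + 1 := ⟨n - 2, by omega⟩
  have hZh : Z.head? = some (z :: K :: (l ++ [c])) := by
    simp [Z, hk, List.range_succ_eq_map]
  have hZl : Z.getLast? = some (z :: K :: c :: l) := by
    have h1 : (l ++ [c]).rotate k = c :: l := by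
      rw [show k = l.length by omega, List.rotate_append_length_eq]
      rfl
    simp [Z, hk, List.range_succ, h1]
  have hZc : Z.IsChain Step := by
    rw [List.isChain_map, List.isChain_range]
    intro i hi
    refine Step.cons (Step.cons ?_ K) z
    rw [Nat.succ_eq_add_one, ← List.rotate_rotate]
    exact step_rotate_one (by simp; omega)
  have hC : ∀ w ∈ (K :: c :: (l ++ [z])) :: (P ++ Z), w.Perm (K :: c :: (l ++ [z])) := by
    intro w hw
    rcases List.mem_cons.1 hw with rfl | hw
    · exact List.Perm.refl _
    rcases List.mem_append.1 hw with hw | hw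
    · rcases hP w hw with ⟨h, -⟩ | ⟨h, -⟩
      exacts [h.1.trans hpr, h.trans hpr]
    · exact (hZ w hw).1
  refine ⟨(K :: c :: (l ++ [z])) :: (P ++ Z), ?_, ⟨?_, hC, ?_, ?_, ?_⟩⟩
  · simp [hPN, Z]
    omega
  · obtain _ | ⟨p, P⟩ := P
    · simp at hPh
    · refine ⟨P ++ Z, ?_⟩
      rw [hrot]
      obtain rfl : p = _ := Option.some_inj.1 hPh
      rfl
  · refine List.nodup_cons.2 ⟨fun h => ?_, hPn.append hZn fun w hw hw' => ?_⟩
    · rcases List.mem_append.1 h with h | h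
      · rcases hP _ h with ⟨-, b, -, v, hv⟩ | ⟨-, -, b, hb, v, hv⟩
        · exact hKc (List.cons.inj hv).1
        · exact hKl ((List.cons.inj hv).1 ▸ hb)
      · obtain ⟨-, v, hv⟩ := hZ _ h
        exact hKz (List.cons.inj hv).1
    · obtain ⟨-, v, rfl⟩ := hZ _ hw'
      rcases hP _ hw with ⟨-, b, -, v, hv⟩ | ⟨-, -, b, hb, v, hv⟩
      · exact hcz (List.cons.inj hv).1.symm
      · exact hzl ((List.cons.inj hv).1 ▸ hb)
  · have h1 : (P ++ Z).IsChain Step := by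
      refine hPc.append hZc fun w hw w' hw' => ?_
      rw [hPl] at hw
      rw [hZh] at hw'
      obtain rfl := Option.some_inj.1 hw
      obtain rfl := Option.some_inj.1 hw'
      exact step_rotate c (List.cons_ne_nil z _)
    have h2 : ((P ++ Z) ++ [K :: c :: (l ++ [z])]).IsChain Step := by
      refine h1.append (List.isChain_singleton _) fun w hw w' hw' => ?_
      rw [List.getLast?_append, hZl] at hw
      obtain rfl := Option.some_inj.1 hw
      obtain rfl := Option.some_inj.1 hw'
      exact step_rotate z (List.cons_ne_nil K _)
    refine h2.cons fun w hw => ?_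
    rw [List.append_assoc, List.head?_append, hPh] at hw
    obtain rfl := Option.some_inj.1 hw
    rw [← hrot]
    exact step_rotate_one (by simp)
  · intro q hq hqK
    have hodd : ∀ w ∈ (K :: c :: (l ++ [z])) :: (P ++ Z),
        (inversions w + inversions (w.map (swap q K))) % 2 = 1 := fun w hw =>
      inversions_map_swap ((hC w hw).nodup_iff.2 hnd) ((hC w hw).symm.subset hq)
        ((hC w hw).symm.subset List.mem_cons_self) hqK
    have hfix : ∀ a, a ≠ q → a ≠ K → swap q K a = a := fun a h h' => swap_apply_of_ne_of_ne h h'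
    -- The neighbours of the first word.
    have hfirst : (K :: c :: (l ++ [z])).map (swap q K) ∉ (K :: c :: (l ++ [z])) :: (P ++ Z) := by
      intro h
      have h0 := hodd _ List.mem_cons_self
      rcases List.mem_cons.1 h with h | h
      · simp only [List.map_cons, swap_apply_right, List.cons.injEq] at h
        exact hqK h.1
      rcases List.mem_append.1 h with h | h
      · rcases hP _ h with ⟨-, b, hb, v, hv⟩ | ⟨-, h1, -⟩
        · simp only [List.map_cons, swap_apply_right, List.cons.injEq] at hv
          obtain ⟨rfl, rfl, -⟩ := hv
          rw [swap_apply_left] at hb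
          simp [hKl, hKz] at hb
        · omega
      · obtain ⟨-, v, hv⟩ := hZ _ h
        simp only [List.map_cons, swap_apply_right, List.cons.injEq] at hv
        obtain ⟨rfl, h1, -⟩ := hv
        rw [hfix c hcz (Ne.symm hKc)] at h1
        exact hKc h1.symm
    have hinv : ∀ w : List ℕ, (w.map (swap q K)).map (swap q K) = w := by
      intro w
      rw [List.map_map]
      refine (List.map_congr_left fun a _ => ?_).trans (List.map_id w)
      exact swap_apply_self q K a
    -- Apart from the first word, the first letter of a word is not `K`.
    have hhead : ∀ a v, a :: v ∈ P ++ Z → (a :: v).map (swap q K) ∈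
        (K :: c :: (l ++ [z])) :: (P ++ Z) → a ≠ q ∧ a ≠ K ∧ (a :: v).map (swap q K) ∈ P ++ Z := by
      intro a v hw hw'
      have hne : ∀ b v', b :: v' ∈ P ++ Z → b ≠ K := by
        rintro b v' hb rfl
        rcases List.mem_append.1 hb with h | h
        · rcases hP _ h with ⟨-, b, -, v, hv⟩ | ⟨-, -, b, hb, v, hv⟩
          · exact hKc (List.cons.inj hv).1
          · exact hKl ((List.cons.inj hv).1 ▸ hb)
        · obtain ⟨-, v, hv⟩ := hZ _ h
          exact hKz (List.cons.inj hv).1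
      have hmem : (a :: v).map (swap q K) ∈ P ++ Z := by
        rcases List.mem_cons.1 hw' with h | h
        · exfalso
          refine hfirst ?_
          rw [← h, hinv]
          exact List.mem_cons_of_mem _ hw
        · exact h
      refine ⟨?_, hne a v hw, hmem⟩
      rintro rfl
      rw [List.map_cons, swap_apply_left] at hmem
      exact hne _ _ hmem rfl
    intro w hw hw'
    rcases List.mem_cons.1 hw with rfl | hwPZ
    · exact hfirst hw'
    have h0 := hodd w hw
    rcases List.mem_append.1 hwPZ with hwP | hwZ
    · rcases hP w hwP with ⟨h1, b, hb, v, rfl⟩ | ⟨-, h1, b, hb, v, rfl⟩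
      · obtain ⟨h2, h3, h4⟩ := hhead _ _ hwPZ hw'
        rcases List.mem_append.1 h4 with h4 | h4
        · rcases hP _ h4 with ⟨h5, -⟩ | ⟨-, -, b', hb', v', hv'⟩
          · have h6 := h1.2
            have h7 := h5.2
            omega
          · rw [List.map_cons, hfix _ h2 h3, List.cons.injEq] at hv'
            exact hcl (hv'.1 ▸ hb')
        · obtain ⟨-, v', hv'⟩ := hZ _ h4
          rw [List.map_cons, hfix _ h2 h3, List.cons.injEq] at hv'
          exact hcz hv'.1
      · obtain ⟨h2, h3, h4⟩ := hhead _ _ hwPZ hw'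
        rcases List.mem_append.1 h4 with h4 | h4
        · rcases hP _ h4 with ⟨-, b', -, v', hv'⟩ | ⟨-, h5, -⟩
          · rw [List.map_cons, hfix _ h2 h3, List.cons.injEq] at hv'
            exact hcl (hv'.1 ▸ hb)
          · omega
        · obtain ⟨-, v', hv'⟩ := hZ _ h4
          rw [List.map_cons, hfix _ h2 h3, List.cons.injEq] at hv'
          exact hzl (hv'.1 ▸ hb)
    · obtain ⟨-, v, rfl⟩ := hZ w hwZ
      obtain ⟨h2, h3, h4⟩ := hhead _ _ hwPZ hw'
      rcases List.mem_append.1 h4 with h4 | h4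
      · rcases hP _ h4 with ⟨-, b', -, v', hv'⟩ | ⟨-, -, b', hb', v', hv'⟩
        · rw [List.map_cons, hfix _ h2 h3, List.cons.injEq] at hv'
          exact hcz hv'.1.symm
        · rw [List.map_cons, hfix _ h2 h3, List.cons.injEq] at hv'
          exact hzl (hv'.1 ▸ hb')
      · obtain ⟨-, v', hv'⟩ := hZ _ h4
        simp only [List.map_cons, swap_apply_right, List.cons.injEq] at hv'
        exact hqK hv'.2.1

/-! ### From words to permutations -/

/-- The vector notation of a permutation, read from right to left. -/
def wordOf {k : ℕ} (σ : Perm (Fin k)) : List ℕ := (List.ofFn fun i => (σ i : ℕ)).reverse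

theorem wordOf_injective {k : ℕ} : Function.Injective (wordOf (k := k)) := by
  intro σ τ h
  ext i
  exact congrFun (List.ofFn_injective (List.reverse_injective h)) i

theorem wordOf_one {k : ℕ} : wordOf (1 : Perm (Fin k)) = (List.range k).reverse := by
  rw [wordOf]
  congr 1
  apply List.ext_getElem <;> simp

theorem exists_wordOf_eq {k : ℕ} {w : List ℕ} (hw : w.Perm (List.range k).reverse) :
    ∃ σ : Perm (Fin k), wordOf σ = w := by
  have hp : w.reverse.Perm (List.range k) :=
    (List.reverse_perm w).trans (hw.trans (List.reverse_perm _))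
  have hl : w.reverse.length = k := by rw [hp.length_eq, List.length_range]
  have hn : w.reverse.Nodup := hp.nodup_iff.2 List.nodup_range
  have hlt : ∀ i (h : i < w.reverse.length), w.reverse[i] < k := fun i h =>
    List.mem_range.1 (hp.subset (List.getElem_mem h))
  let f : Fin k → Fin k := fun i => ⟨w.reverse[(i : ℕ)]'(by omega), hlt _ _⟩
  have hf : Function.Injective f := by
    intro i j hij
    exact Fin.ext ((hn.getElem_inj_iff).1 (Fin.mk.inj hij))
  refine ⟨Equiv.ofBijective f (Finite.injective_iff_bijective.1 hf), ?_⟩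
  rw [wordOf, List.reverse_eq_iff]
  apply List.ext_getElem
  · simpa using hl.symm
  · intro i h1 h2
    simp [f]

theorem wordOf_pushTo {k : ℕ} {σ : Perm (Fin k)} {x y : List ℕ} {a : ℕ}
    (h : wordOf σ = x ++ a :: y) {i j : Fin k} (hi : (i : ℕ) = 0) (hj : (j : ℕ) = y.length) :
    wordOf (pushTo i j σ) = x ++ y ++ [a] := by
  have h1 : (List.ofFn fun i => (σ i : ℕ)) = y.reverse ++ a :: x.reverse := by
    rw [wordOf, List.reverse_eq_iff] at h
    simpa using h
  have hk : k = y.length + (x.length + 1) := by simpa using congrArg List.length h1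
  have h2 : ∀ (p : Fin k) (hp : (p : ℕ) < (y.reverse ++ a :: x.reverse).length),
      (σ p : ℕ) = (y.reverse ++ a :: x.reverse)[(p : ℕ)] := by
    intro p hp
    simp only [← h1, List.getElem_ofFn]
  rw [wordOf, List.reverse_eq_iff]
  apply List.ext_getElem
  · simp; omega
  · intro p hp hp'
    have hpk : p < k := by simpa using hp
    have e : (x ++ y ++ [a]).reverse = a :: (y.reverse ++ x.reverse) := by simp
    simp only [List.getElem_ofFn, e]
    obtain _ | p := p
    · have h3 : (⟨0, hpk⟩ : Fin k) = i := Fin.ext hi.symm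
      rw [h3, pushTo_apply_left (show i ≤ j by rw [Fin.le_def]; omega),
        h2 j (by simp; omega)]
      simp [hj]
    · rw [List.getElem_cons_succ]
      by_cases hpy : p < y.length
      · rw [pushTo_apply_succ (i := i) (j := j) (p := ⟨p, by omega⟩) (q := ⟨p + 1, hpk⟩)
          (by rw [Fin.le_def]; omega) (by rw [Fin.lt_def]; simpa [hj] using hpy) rfl,
          h2 _ (by simp; omega), List.getElem_append_left (by simpa using hpy),
          List.getElem_append_left (by simpa using hpy)]
      · rw [pushTo_apply_of_gt (by rw [Fin.lt_def]; simp only [hj]; omega), h2 _ (by simp; omega),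
          List.getElem_append_right (by simp; omega),
          List.getElem_append_right (by simpa using hpy)]
        simp only [List.length_reverse, show p + 1 - y.length = p - y.length + 1 by omega,
          List.getElem_cons_succ]

/-- On words read from right to left, the steps are the push-to-the-top transitions. -/
theorem exists_pushTo_of_step {k : ℕ} {σ τ : Perm (Fin k)} (h : Step (wordOf σ) (wordOf τ)) :
    ∃ t ∈ topTransitions k, τ = t σ := by
  obtain ⟨x, a, y, hy, h1, h2⟩ := h
  have hk : k = x.length + (y.length + 1) := by simpa [wordOf] using congrArg List.length h1
  have hy' : 0 < y.length := List.length_pos_iff.2 hy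
  refine ⟨_, ⟨⟨0, by omega⟩, ⟨y.length, by omega⟩, rfl, hy', rfl⟩, ?_⟩
  exact wordOf_injective (h2.trans (wordOf_pushTo h1 rfl rfl).symm)

theorem wordOf_swap_mul {k : ℕ} (a b : Fin k) (σ : Perm (Fin k)) :
    wordOf (swap a b * σ) = (wordOf σ).map (swap (a : ℕ) b) := by
  have h : ∀ c : Fin k, ((swap a b c : Fin k) : ℕ) = swap (a : ℕ) b c := by
    intro c
    simp only [swap_apply_def, Fin.ext_iff]
    split_ifs <;> rfl
  simp only [wordOf, List.map_reverse, List.map_ofFn, Function.comp_def, Perm.mul_apply, h]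

theorem IsWordCode.exists_isAuxCode {k : ℕ} (hk : 3 ≤ k) {C : List (List ℕ)}
    (hC : IsWordCode (k - 1) (List.range k).reverse C) {i j : Fin k} (hi : (i : ℕ) = 0)
    (hj : (j : ℕ) = k - 1) :
    ∃ c : Fin C.length → Perm (Fin k), IsAuxCode c ∧ StartsWith c 1 (pushTo i j) := by
  obtain ⟨R, hR⟩ := hC.start
  have hlen : C.length = R.length + 2 := by rw [hR]; rfl
  choose c hc using fun i : Fin C.length => exists_wordOf_eq (hC.perm _ (List.getElem_mem i.2))
  have hc' : ∀ i, wordOf (c i) ∈ C := fun i => by rw [hc]; exact List.getElem_mem i.2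
  have hinj : Function.Injective c := by
    intro i j hij
    have h1 := congrArg wordOf hij
    rw [hc, hc] at h1
    exact Fin.ext ((hC.nodup.getElem_inj_iff).1 h1)
  have h0 : c ⟨0, by omega⟩ = 1 := by
    apply wordOf_injective
    rw [hc, wordOf_one]
    simp [hR]
  have hchain := List.isChain_iff_getElem.1 hC.chain
  simp only [List.length_append, List.length_singleton] at hchain
  refine ⟨c, ⟨⟨⟨hinj, fun r h => exists_pushTo_of_step ?_⟩, by omega, exists_pushTo_of_step ?_⟩, ?_⟩,
    by omega, h0, ?_⟩
  · rw [hc, hc]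
    have := hchain r (by omega)
    rwa [List.getElem_append_left (by omega), List.getElem_append_left h] at this
  · rw [h0, hc, wordOf_one]
    have := hchain (C.length - 1) (by omega)
    rw [List.getElem_append_left (by omega), List.getElem_append_right (by omega)] at this
    simpa using this
  · rintro q l hl hql _ ⟨r, rfl⟩ ⟨s, hs⟩
    refine hC.aux q (by simp) (by have : (q : ℕ) < l := hql; omega) (wordOf (c r)) (hc' r) ?_
    have h1 : k - 1 = (l : ℕ) := by omega
    rw [h1, ← wordOf_swap_mul, ← hs]
    exact hc' s
  · apply wordOf_injective
    obtain ⟨m, rfl⟩ : ∃ m, k = m + 1 := ⟨k - 1, by omega⟩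
    have h1 : wordOf (1 : Perm (Fin (m + 1))) = [] ++ m :: (List.range m).reverse := by
      rw [wordOf_one, List.range_succ]
      simp
    rw [hc, wordOf_pushTo h1 hi (by simpa using hj)]
    simp [hR, List.range_succ]

/-! ### The sizes -/

theorem exists_isWordCode_range {k N : ℕ} (hk : 3 ≤ k) (h : HasTour k N) :
    ∃ C, C.length = N ∧ IsWordCode (k - 1) (List.range k).reverse C :=
  h.isWordCode (List.nodup_reverse.2 List.nodup_range) (by simp) (by omega) (by simp; omega)

theorem exists_isWordCode_range_even {n : ℕ} (hn : Odd n) (h3 : 3 ≤ n) (Ns : List ℕ)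
    (hNl : Ns.length + 2 = n) (hNs : ∀ N ∈ Ns, HasTour n N) :
    ∃ C, C.length = Ns.sum + 2 * n - 1 ∧ IsWordCode n (List.range (n + 1)).reverse C := by
  obtain ⟨m, rfl⟩ : ∃ m, n = m + 2 := ⟨n - 2, by omega⟩
  have hr : (List.range (m + 2 + 1)).reverse =
      (m + 2) :: (m + 1) :: ((List.range m).map Nat.succ).reverse ++ [0] := by
    rw [List.range_succ, List.range_succ, List.range_succ_eq_map]
    simp
  have hnd : (List.range (m + 2 + 1)).reverse.Nodup := List.nodup_reverse.2 List.nodup_range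
  rw [hr] at hnd ⊢
  exact exists_isWordCode_even hn h3 hnd (by simp) Ns (by simp; omega) hNs

/-- The size of the code that is constructed for even `k > 6`. -/
def evenSize (k : ℕ) : ℕ := (k - 3) * ((k - 1).factorial / 2) + (2 * k - 3)

theorem lt_evenSize_div {k : ℕ} (hk : 6 < k) :
    ((k : ℝ) - 3) / k < (evenSize k : ℝ) / ((k.factorial : ℝ) / 2) := by
  obtain ⟨m, rfl⟩ : ∃ m, k = m + 3 := ⟨k - 3, by omega⟩
  have h2 : 2 ∣ (m + 2).factorial := Nat.dvd_factorial (by omega) (by omega)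
  have hf : ((m + 3).factorial : ℝ) = ((m : ℝ) + 3) * (m + 2).factorial := by
    rw [Nat.factorial_succ]
    push_cast
    ring
  have hpos : (0 : ℝ) < (m + 2).factorial := by exact_mod_cast Nat.factorial_pos _
  have he : (evenSize (m + 3) : ℝ) = m * ((m + 2).factorial / 2) + (2 * m + 3) := by
    have h3 : evenSize (m + 3) = m * ((m + 2).factorial / 2) + (2 * m + 3) := by
      simp only [evenSize, show m + 3 - 3 = m by omega, show m + 3 - 1 = m + 2 by omega]
      omega
    rw [h3]
    push_cast [Nat.cast_div h2 (by norm_num : (2 : ℝ) ≠ 0)]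
    ring
  have hm : (0 : ℝ) ≤ m := Nat.cast_nonneg m
  rw [he, hf, div_lt_div_iff₀ (by positivity) (by positivity)]
  push_cast
  nlinarith

end PushToTop

theorem mainTheorem2 :
    ∃ ρ : ℕ → ℝ,
      (∀ k : ℕ, 6 < k → Even k → ((k : ℝ) - 3) / (k : ℝ) < ρ k) ∧
      ∀ (k : ℕ) (hk : 3 ≤ k),
        ∃ M : ℕ, (M : ℝ) = PushToTop.auxSize ρ k ∧
          ∃ c : Fin M → Equiv.Perm (Fin k),
            PushToTop.IsAuxCode c ∧
            PushToTop.StartsWith c 1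
              (PushToTop.pushTo (⟨0, by omega⟩ : Fin k) (⟨k - 1, by omega⟩ : Fin k)) := by
  refine ⟨fun k => (PushToTop.evenSize k : ℝ) / ((k.factorial : ℝ) / 2),
    fun k hk _ => PushToTop.lt_evenSize_div hk, fun k hk => ?_⟩
  suffices h : ∃ C : List (List ℕ),
      (C.length : ℝ) = PushToTop.auxSize
        (fun k => (PushToTop.evenSize k : ℝ) / ((k.factorial : ℝ) / 2)) k ∧
      PushToTop.IsWordCode (k - 1) (List.range k).reverse C by
    obtain ⟨C, hCl, hC⟩ := h
    exact ⟨C.length, hCl, hC.exists_isAuxCode hk rfl rfl⟩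
  have hpos : (0 : ℝ) < k.factorial := by exact_mod_cast Nat.factorial_pos k
  have hcast : ((k.factorial / 2 : ℕ) : ℝ) = (k.factorial : ℝ) / 2 := by
    rw [Nat.cast_div (Nat.dvd_factorial (by omega) (by omega)) (by norm_num)]
    norm_num
  unfold PushToTop.auxSize
  split_ifs with h4 h5 h6 hodd
  · subst h4
    obtain ⟨C, hCl, hC⟩ := PushToTop.exists_isWordCode_range_even (n := 3) (by decide) le_rfl [3] rfl
      (by simpa using PushToTop.hasTour_three)
    exact ⟨C, by rw [hCl]; norm_num, hC⟩
  · subst h5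
    obtain ⟨C, hCl, hC⟩ := PushToTop.exists_isWordCode_range hk PushToTop.hasTour_five_57
    exact ⟨C, by rw [hCl]; norm_num, hC⟩
  · -- The tours of the three classes need not have the same size: `178 = 57 + 57 + 55 + 9`.
    subst h6
    obtain ⟨C, hCl, hC⟩ := PushToTop.exists_isWordCode_range_even (n := 5) (by decide) (by norm_num)
      [57, 57, 55] rfl (by simpa using
        ⟨PushToTop.hasTour_five_57, PushToTop.hasTour_five_55⟩)
    exact ⟨C, by rw [hCl]; norm_num, hC⟩
  · have htour : PushToTop.HasTour k (k.factorial / 2) := by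
      rcases Nat.lt_or_ge k 7 with h7 | h7
      · obtain rfl : k = 3 := by
          obtain ⟨a, ha⟩ := hodd
          omega
        exact PushToTop.hasTour_three
      · exact PushToTop.hasTour_factorial hodd h7
    obtain ⟨C, hCl, hC⟩ := PushToTop.exists_isWordCode_range hk htour
    exact ⟨C, by rw [hCl, hcast], hC⟩
  · obtain ⟨a, ha⟩ := Nat.not_odd_iff_even.1 hodd
    obtain ⟨n, rfl⟩ : ∃ n, k = n + 1 := ⟨k - 1, by omega⟩
    have hn : Odd n := ⟨a - 1, by omega⟩
    obtain ⟨C, hCl, hC⟩ := PushToTop.exists_isWordCode_range_even hn (by omega)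
      (List.replicate (n - 2) (n.factorial / 2)) (by simp; omega) fun N hN => by
        rw [List.eq_of_mem_replicate hN]
        exact PushToTop.hasTour_factorial hn (by omega)
    refine ⟨C, ?_, hC⟩
    have hsize : C.length = PushToTop.evenSize (n + 1) := by
      rw [hCl, List.sum_replicate, smul_eq_mul, PushToTop.evenSize, Nat.add_sub_cancel,
        show n + 1 - 3 = n - 2 by omega]
      omega
    rw [hsize]
    field_simp
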